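/- Let $(\lambda_n)_{n\ge 1}$ be real numbers with $\frac14\le\lambda_n\le\lambda<\frac12$ for all $n$, and let $s_n=\lambda_1\cdots\lambda_n$. Starting from the unit square $Q_0=[0,1]^2\subset\mathbb{C}$, replace at step $n\ge 1$ each square of side $s_{n-1}$ by the four closed squares of side $s_n$ contained in it that have sides parallel to the axes and share a vertex with it; this gives $4^n$ squares $Q^n_j$, $1\le j\le 4^n$, of side $s_n$. Let $$K=\bigcap_{n\ge1}\bigcup_{j=1}^{4^n}Q^n_j ,$$ let $\mu$ be the Borel probability measure on $K$ with $\mu(Q^n_j)=4^{-n}$ for all $n$ and $j$, and let $a_n=\dfrac{1}{4^n s_n}$. Let $E$ be the set of points $z\in K$ for which the principal value $$\lim_{\varepsilon\to0^+}\int_{|w-z|>\varepsilon}\frac{1}{w-z}\,d\mu(w)$$ exists (as a complex number). **Theorem.** If $\lim_{n\to\infty}a_n=0$, then the Hausdorff dimension of $E$ is at least $1$. In particular, if $K$ has Hausdorff dimension $1$, then $E$ has Hausdorff dimension exactly $1$. -/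

import Mathlib

open Filter Topology MeasureTheory

namespace CornerCantor

/-- The side length `s n = lam 1 * ... * lam n` of the squares of generation `n` (so `s 0 = 1`). -/
noncomputable def side (lam : ℕ → ℝ) (n : ℕ) : ℝ := ∏ i ∈ Finset.Icc 1 n, lam i

/-- The linear density `a n = 1 / (4 ^ n * s n)`. -/
noncomputable def density (lam : ℕ → ℝ) (n : ℕ) : ℝ := 1 / (4 ^ n * side lam n)

/-- `0` or `1`, as a real number. -/
def bit (b : Bool) : ℝ := if b then 1 else 0

/-- The four vertices `0, 1, i, 1 + i` of the unit square. -/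
def vertex (v : Bool × Bool) : ℂ := ⟨bit v.1, bit v.2⟩

/-- The lower left corner of the square of generation `n` that is reached from the unit square by
choosing successively the corner squares at the vertices `w 0, ..., w (n - 1)`. A square of side
`s n` with lower left corner `c` has its four corner squares of side `s (n + 1)` at
`c + (s n - s (n + 1)) v`, where `v` is one of `0, 1, i, 1 + i`. -/
noncomputable def corner (lam : ℕ → ℝ) (w : ℕ → Bool × Bool) : ℕ → ℂ
  | 0 => 0
  | n + 1 => corner lam w n + ((side lam n - side lam (n + 1) : ℝ) : ℂ) * vertex (w n)

/-- The closed square of generation `n` with address `w 0, ..., w (n - 1)`. -/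
def square (lam : ℕ → ℝ) (w : ℕ → Bool × Bool) (n : ℕ) : Set ℂ :=
  Set.Icc (corner lam w n).re ((corner lam w n).re + side lam n) ×ℂ
    Set.Icc (corner lam w n).im ((corner lam w n).im + side lam n)

/-- The family of the `4 ^ n` squares of generation `n`. -/
def generation (lam : ℕ → ℝ) (n : ℕ) : Set (Set ℂ) :=
  Set.range fun w : ℕ → Bool × Bool => square lam w n

/-- The four-corner Cantor set: the intersection over `n ≥ 1` of the unions of the squares of
generation `n`. -/
def cantorSet (lam : ℕ → ℝ) : Set ℂ :=
  ⋂ n ≥ 1, ⋃ Q ∈ generation lam n, Q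

/-- The point with infinite address `w`: the limit of the lower left corners of the squares with
addresses `w 0, ..., w (n - 1)`. -/
noncomputable def point (lam : ℕ → ℝ) (w : ℕ → Bool × Bool) : ℂ :=
  ∑' n, ((side lam n - side lam (n + 1) : ℝ) : ℂ) * vertex (w n)

/-- The uniform probability measure on the four letters. -/
noncomputable def letterMeasure : Measure (Bool × Bool) :=
  (PMF.uniformOfFintype (Bool × Bool)).toMeasure

instance : IsProbabilityMeasure letterMeasure := by
  unfold letterMeasure; infer_instance

/-- The natural measure of the Cantor set: the law of the point whose address is a sequence of
independent uniformly distributed letters. By `cantorMeasure_square` and `cantorMeasure_compl`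
below it is the Borel probability measure on the Cantor set that gives mass `4 ^ (-n)` to each
square of generation `n`. -/
noncomputable def cantorMeasure (lam : ℕ → ℝ) : Measure ℂ :=
  (Measure.infinitePi fun _ : ℕ => letterMeasure).map (point lam)

/-- The Cauchy integral of `μ` has the principal value `L` at `z`: the truncated integrals of
`1 / (w - z)` over `|w - z| > ε` converge to `L` as `ε` decreases to `0`. For a finite measure `μ`
the truncated integrands are bounded, hence integrable. -/
def HasPrincipalValue (μ : Measure ℂ) (z L : ℂ) : Prop :=
  Tendsto (fun ε : ℝ => ∫ w in {w : ℂ | ε < ‖w - z‖}, 1 / (w - z) ∂μ) (𝓝[>] 0) (𝓝 L)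

/-- The points of the Cantor set at which the principal value of the Cauchy integral of the
natural measure exists. -/
def principalValueSet (lam : ℕ → ℝ) : Set ℂ :=
  {z ∈ cantorSet lam | ∃ L : ℂ, HasPrincipalValue (cantorMeasure lam) z L}

/-! The natural measure is the one described in its doc comment. -/

section Natural

variable {lam : ℕ → ℝ} {l : ℝ}

theorem side_succ (lam : ℕ → ℝ) (n : ℕ) : side lam (n + 1) = side lam n * lam (n + 1) := by
  unfold side
  rw [Finset.prod_Icc_succ_top (by omega)]

theorem side_pos (h : ∀ n ≥ 1, 1 / 4 ≤ lam n ∧ lam n ≤ l) (n : ℕ) : 0 < side lam n := by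
  unfold side
  refine Finset.prod_pos fun i hi => ?_
  have := (h i (Finset.mem_Icc.1 hi).1).1
  linarith

theorem two_mul_side_lt (hl : l < 1 / 2) (h : ∀ n ≥ 1, 1 / 4 ≤ lam n ∧ lam n ≤ l) (n : ℕ) :
    2 * side lam (n + 1) < side lam n := by
  have h1 := side_pos h n
  have h2 := (h (n + 1) (by omega)).2
  rw [side_succ]
  nlinarith

theorem corner_re_succ (lam : ℕ → ℝ) (w : ℕ → Bool × Bool) (n : ℕ) : (corner lam w (n + 1)).re =
    (corner lam w n).re + (side lam n - side lam (n + 1)) * bit (w n).1 := by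
  simp only [corner, vertex, Complex.add_re, Complex.re_ofReal_mul]

theorem corner_im_succ (lam : ℕ → ℝ) (w : ℕ → Bool × Bool) (n : ℕ) : (corner lam w (n + 1)).im =
    (corner lam w n).im + (side lam n - side lam (n + 1)) * bit (w n).2 := by
  simp only [corner, vertex, Complex.add_im, Complex.im_ofReal_mul]

theorem bit_nonneg (b : Bool) : 0 ≤ bit b := by cases b <;> simp [bit]

theorem bit_le_one (b : Bool) : bit b ≤ 1 := by cases b <;> simp [bit]

theorem square_succ_subset (hl : l < 1 / 2) (h : ∀ n ≥ 1, 1 / 4 ≤ lam n ∧ lam n ≤ l)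
    (w : ℕ → Bool × Bool) (n : ℕ) : square lam w (n + 1) ⊆ square lam w n := by
  intro z hz
  have h1 := two_mul_side_lt hl h n
  have h2 := side_pos h (n + 1)
  have e1 := bit_nonneg (w n).1
  have e2 := bit_le_one (w n).1
  have e3 := bit_nonneg (w n).2
  have e4 := bit_le_one (w n).2
  simp only [square, Complex.mem_reProdIm, Set.mem_Icc, corner_re_succ, corner_im_succ] at hz ⊢
  obtain ⟨⟨a1, a2⟩, a3, a4⟩ := hz
  refine ⟨⟨?_, ?_⟩, ?_, ?_⟩ <;> nlinarith

theorem square_antitone (hl : l < 1 / 2) (h : ∀ n ≥ 1, 1 / 4 ≤ lam n ∧ lam n ≤ l)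
    (w : ℕ → Bool × Bool) : Antitone (square lam w) :=
  antitone_nat_of_succ_le fun n => square_succ_subset hl h w n

theorem corner_mem (h : ∀ n ≥ 1, 1 / 4 ≤ lam n ∧ lam n ≤ l) (w : ℕ → Bool × Bool) (n : ℕ) :
    corner lam w n ∈ square lam w n := by
  have := (side_pos h n).le
  simp only [square, Complex.mem_reProdIm, Set.mem_Icc]
  refine ⟨⟨?_, ?_⟩, ?_, ?_⟩ <;> linarith

theorem isClosed_square (lam : ℕ → ℝ) (w : ℕ → Bool × Bool) (n : ℕ) :
    IsClosed (square lam w n) :=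
  isClosed_Icc.reProdIm isClosed_Icc

theorem corner_eq_sum (lam : ℕ → ℝ) (w : ℕ → Bool × Bool) (n : ℕ) : corner lam w n =
    ∑ k ∈ Finset.range n, ((side lam k - side lam (k + 1) : ℝ) : ℂ) * vertex (w k) := by
  induction n with
  | zero => simp [corner]
  | succ n ih => rw [Finset.sum_range_succ, ← ih, corner]

theorem norm_vertex_le (v : Bool × Bool) : ‖vertex v‖ ≤ 2 := by
  refine (Complex.norm_le_abs_re_add_abs_im _).trans ?_
  simp only [vertex]
  rw [abs_of_nonneg (bit_nonneg _), abs_of_nonneg (bit_nonneg _)]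
  linarith [bit_le_one v.1, bit_le_one v.2]

theorem norm_term_le (hl : l < 1 / 2) (h : ∀ n ≥ 1, 1 / 4 ≤ lam n ∧ lam n ≤ l)
    (n : ℕ) (v : Bool × Bool) :
    ‖((side lam n - side lam (n + 1) : ℝ) : ℂ) * vertex v‖ ≤
      2 * (side lam n - side lam (n + 1)) := by
  have h1 := two_mul_side_lt hl h n
  have h2 := side_pos h (n + 1)
  rw [norm_mul, Complex.norm_real, Real.norm_of_nonneg (by linarith)]
  nlinarith [norm_vertex_le v]

theorem summable_diff (hl : l < 1 / 2) (h : ∀ n ≥ 1, 1 / 4 ≤ lam n ∧ lam n ≤ l) :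
    Summable fun n => 2 * (side lam n - side lam (n + 1)) := by
  refine Summable.mul_left 2 ?_
  refine summable_of_sum_range_le (c := 1) (fun n => ?_) fun n => ?_
  · linarith [two_mul_side_lt hl h n, side_pos h (n + 1)]
  · rw [Finset.sum_range_sub']
    have : side lam 0 = 1 := by simp [side]
    linarith [side_pos h n]

theorem tendsto_corner (hl : l < 1 / 2) (h : ∀ n ≥ 1, 1 / 4 ≤ lam n ∧ lam n ≤ l)
    (w : ℕ → Bool × Bool) : Tendsto (corner lam w) atTop (𝓝 (point lam w)) := by
  have hs : Summable fun n => ((side lam n - side lam (n + 1) : ℝ) : ℂ) * vertex (w n) :=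
    Summable.of_norm_bounded (summable_diff hl h) fun n => norm_term_le hl h n _
  have := hs.hasSum.tendsto_sum_nat
  simp only [← corner_eq_sum] at this
  exact this

theorem point_mem_square (hl : l < 1 / 2) (h : ∀ n ≥ 1, 1 / 4 ≤ lam n ∧ lam n ≤ l)
    (w : ℕ → Bool × Bool) (n : ℕ) : point lam w ∈ square lam w n := by
  refine (isClosed_square lam w n).mem_of_tendsto (tendsto_corner hl h w) ?_
  filter_upwards [eventually_ge_atTop n] with m hm
  exact square_antitone hl h w hm (corner_mem h w m)

theorem continuous_point (hl : l < 1 / 2) (h : ∀ n ≥ 1, 1 / 4 ≤ lam n ∧ lam n ≤ l) :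
    Continuous (point lam) := by
  refine continuous_tsum (fun n => ?_) (summable_diff hl h) fun n w => norm_term_le hl h n _
  have : Continuous vertex := continuous_of_discreteTopology
  exact continuous_const.mul (this.comp (continuous_apply n))

theorem corner_congr {w w' : ℕ → Bool × Bool} {n : ℕ} (e : ∀ k < n, w k = w' k) :
    corner lam w n = corner lam w' n := by
  rw [corner_eq_sum, corner_eq_sum]
  exact Finset.sum_congr rfl fun k hk => by rw [e k (Finset.mem_range.1 hk)]

theorem bit_sep {b b' : Bool} {c d s x : ℝ} (hds : s < d) (_hs : 0 < s)
    (h1 : c + d * bit b ≤ x) (h2 : x ≤ c + d * bit b + s)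
    (h3 : c + d * bit b' ≤ x) (h4 : x ≤ c + d * bit b' + s) : b = b' := by
  cases b <;> cases b' <;> simp [bit] at * <;> linarith

theorem point_mem_square_iff (hl : l < 1 / 2) (h : ∀ n ≥ 1, 1 / 4 ≤ lam n ∧ lam n ≤ l)
    (w w' : ℕ → Bool × Bool) (n : ℕ) :
    point lam w' ∈ square lam w n ↔ ∀ k < n, w' k = w k := by
  constructor
  · intro hz k
    induction k using Nat.strong_induction_on with
    | _ k ih =>
      intro hk
      have e := corner_congr (lam := lam) fun j hj => ih j hj (hj.trans hk)
      have z1 := square_antitone hl h w (show k + 1 ≤ n from hk) hz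
      have z2 := point_mem_square hl h w' (k + 1)
      simp only [square, Complex.mem_reProdIm, Set.mem_Icc, corner_re_succ, corner_im_succ, e]
        at z1 z2
      have h1 := two_mul_side_lt hl h k
      have h2 := side_pos h (k + 1)
      exact Prod.ext
        (bit_sep (by linarith) h2 z2.1.1 z2.1.2 z1.1.1 z1.1.2)
        (bit_sep (by linarith) h2 z2.2.1 z2.2.2 z1.2.1 z1.2.2)
  · intro e
    have := point_mem_square hl h w' n
    simpa only [square, corner_congr e] using this

theorem point_mem_cantorSet (hl : l < 1 / 2) (h : ∀ n ≥ 1, 1 / 4 ≤ lam n ∧ lam n ≤ l)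
    (w : ℕ → Bool × Bool) : point lam w ∈ cantorSet lam := by
  simp only [cantorSet, Set.mem_iInter, Set.mem_iUnion]
  exact fun n _ => ⟨_, ⟨w, rfl⟩, point_mem_square hl h w n⟩

theorem isProbabilityMeasure_cantorMeasure (hl : l < 1 / 2)
    (h : ∀ n ≥ 1, 1 / 4 ≤ lam n ∧ lam n ≤ l) : IsProbabilityMeasure (cantorMeasure lam) :=
  Measure.isProbabilityMeasure_map (continuous_point hl h).measurable.aemeasurable

theorem cantorMeasure_compl (hl : l < 1 / 2) (h : ∀ n ≥ 1, 1 / 4 ≤ lam n ∧ lam n ≤ l) :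
    cantorMeasure lam (cantorSet lam)ᶜ = 0 := by
  have : ∀ᵐ z ∂(cantorMeasure lam), z ∈ Set.range (point lam) := by
    have hr : IsClosed (Set.range (point lam)) :=
      (isCompact_range (continuous_point hl h)).isClosed
    exact (ae_map_iff (p := fun z => z ∈ Set.range (point lam))
      (continuous_point hl h).measurable.aemeasurable hr.measurableSet).2
      (Eventually.of_forall fun w => ⟨w, rfl⟩)
  refine measure_mono_null ?_ this
  rintro z hz ⟨w, rfl⟩
  exact hz (point_mem_cantorSet hl h w)

theorem cantorMeasure_square (hl : l < 1 / 2) (h : ∀ n ≥ 1, 1 / 4 ≤ lam n ∧ lam n ≤ l)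
    {n : ℕ} {Q : Set ℂ} (hQ : Q ∈ generation lam n) :
    cantorMeasure lam Q = (4 ^ n)⁻¹ := by
  obtain ⟨w, rfl⟩ := hQ
  rw [cantorMeasure, Measure.map_apply (continuous_point hl h).measurable
    (isClosed_square lam w n).measurableSet]
  have : point lam ⁻¹' square lam w n =
      Set.pi (Finset.range n : Set ℕ) fun k => {w k} := by
    ext w'
    simp [point_mem_square_iff hl h]
  rw [this, Measure.infinitePi_pi _ fun _ _ => measurableSet_singleton _]
  have h4 : ∀ v : Bool × Bool, letterMeasure {v} = 4⁻¹ := by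
    intro v
    rw [letterMeasure, PMF.toMeasure_apply_singleton _ _ (measurableSet_singleton _)]
    simp
  simp [h4, ENNReal.inv_pow]

end Natural

end CornerCantor

/-!
The measure is studied on the space of addresses, with the product measure `addressMeasure`. The
Cauchy integral around the point with address `w` splits into the contributions of the shells
"first disagreement with `w` at position `k`"; their real and (negated) imaginary parts are
`increment lam c k w`, of size `O(a k)` with `a = density lam`, which is nonincreasing since all
ratios are at least `1 / 4`. As `a` tends to zero, the principal value exists as soon as the partial
sums of the increments converge (`hasPrincipalValue_of_tendsto`).

These sums need not converge almost everywhere, but they can be steered towards zero at a small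
cost. Three facts about the `n`-th partial sum make this possible. On a square of generation `n` it
oscillates by `O(a n)` only (`abs_partialSum_sub_le`), so the letters known so far determine it up
to that error. Reflecting a square about its axes changes the signs of the two coordinates of
everything that is added inside that square (`increment_flipFrom`), so a stretch of `M` arbitrary
letters, suitably reflected, does not increase the modulus of the sums beyond `O(M * a n)`, up to an
error `O(a n)`. Finally, along a stretch of equal letters the point stays near a vertex, so all
increments have a known sign and a size comparable to `a` (`le_sgn_mul_increment`); `m` forced
letters therefore compensate the errors, where `m` does not depend on `M`, unless `a` halves over
the block. Blocks over which `a` halves contribute a convergent series. This gives the convergence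
of the sums (`exists_tendsto_of_block_decrease`).

Applied to a random address `ω`, this recipe yields a random address `steered lam M m ω` at whose
point the principal value exists. A block of `M + m` steered letters determines the `M` free letters
of `ω` up to one of four reflections, so each square of generation `n` has probability at most
`C * 4 ^ (-n) * (4 ^ (m + 1)) ^ (n / (M + m))`. Since `4 ^ (-n)` is at most the side of the square,
the mass distribution principle bounds the dimension from below by a number that tends to `1` as
`M` grows.
-/

namespace CornerCantor

/-! ### Addresses and increments -/

/-- An infinite address: a sequence of vertices of the unit square. -/
abbrev Address := ℕ → Bool × Bool

/-- The law of an address with independent uniformly distributed letters. -/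
noncomputable def addressMeasure : Measure Address :=
  Measure.infinitePi fun _ : ℕ => letterMeasure

instance : IsProbabilityMeasure addressMeasure := by
  unfold addressMeasure; infer_instance

/-- The addresses that agree with `w` in the first `n` letters. -/
def cyl (w : Address) (n : ℕ) : Set Address := {w' | ∀ i < n, w' i = w i}

/-- The addresses whose first disagreement with `w` is at position `k`. Under `point lam` this is
the part of the Cantor set in the square of generation `k` around `point lam w` but outside the
one of generation `k + 1`. -/
def shell (w : Address) (k : ℕ) : Set Address := cyl w k \ cyl w (k + 1)

/-- The real part (`c = true`) or the imaginary part (`c = false`). -/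
def coord (c : Bool) (z : ℂ) : ℝ := if c then z.re else z.im

/-- The component of a letter that governs the coordinate `c`. -/
def axis (c : Bool) (v : Bool × Bool) : Bool := if c then v.1 else v.2

/-- The sign by which reflecting (`b = true`) or keeping (`b = false`) a coordinate acts. -/
def sgn (b : Bool) : ℝ := if b then -1 else 1

/-- The real kernels behind the Cauchy kernel: `1 / z = kernel true z - i * kernel false z`. -/
noncomputable def kernel (c : Bool) (z : ℂ) : ℝ := coord c z / Complex.normSq z

/-- The addresses after reflecting all letters from position `n` on in the coordinates in which
`g` is `true`; geometrically, a reflection of the square of generation `n` about its axes. -/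
def flipFrom (n : ℕ) (g : Bool × Bool) (w : Address) : Address := fun i =>
  if i < n then w i else (xor (w i).1 g.1, xor (w i).2 g.2)

/-- The contribution of the `k`-th shell around `point lam w` to the integral of `kernel c`. -/
noncomputable def increment (lam : ℕ → ℝ) (c : Bool) (k : ℕ) (w : Address) : ℝ :=
  ∫ w' in shell w k, kernel c (point lam w' - point lam w) ∂addressMeasure

theorem letterMeasure_singleton (v : Bool × Bool) : letterMeasure {v} = 4⁻¹ := by
  rw [letterMeasure, PMF.toMeasure_apply_singleton _ _ (measurableSet_singleton _)]
  simp

theorem setOf_fixed_eq (s : Finset ℕ) (w : Address) :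
    {w' : Address | ∀ i ∈ s, w' i = w i} = Set.pi (s : Set ℕ) fun k => {w k} := by
  ext w'; simp

theorem addressMeasure_fixed (s : Finset ℕ) (w : Address) :
    addressMeasure {w' | ∀ i ∈ s, w' i = w i} = (4 ^ s.card)⁻¹ := by
  rw [setOf_fixed_eq, addressMeasure, Measure.infinitePi_pi _ fun _ _ => measurableSet_singleton _]
  simp [letterMeasure_singleton, ENNReal.inv_pow]

theorem cyl_eq (w : Address) (n : ℕ) : cyl w n = {w' | ∀ i ∈ Finset.range n, w' i = w i} := by
  ext w'; simp [cyl]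

theorem addressMeasure_cyl (w : Address) (n : ℕ) : addressMeasure (cyl w n) = (4 ^ n)⁻¹ := by
  rw [cyl_eq, addressMeasure_fixed, Finset.card_range]

theorem addressMeasure_real_cyl (w : Address) (n : ℕ) :
    addressMeasure.real (cyl w n) = (4 ^ n)⁻¹ := by
  simp [Measure.real, addressMeasure_cyl]

theorem measurableSet_cyl (w : Address) (n : ℕ) : MeasurableSet (cyl w n) := by
  rw [cyl_eq, setOf_fixed_eq]
  exact MeasurableSet.pi (Finset.countable_toSet _) fun _ _ => measurableSet_singleton _

theorem measurableSet_shell (w : Address) (n : ℕ) : MeasurableSet (shell w n) :=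
  (measurableSet_cyl w n).diff (measurableSet_cyl w (n + 1))

theorem cyl_antitone (w : Address) : Antitone (cyl w) :=
  fun _ _ hmn _ hw i hi => hw i (hi.trans_le hmn)

theorem self_mem_cyl (w : Address) (n : ℕ) : w ∈ cyl w n := fun _ _ => rfl

theorem cyl_eq_of_mem {w w' : Address} {n : ℕ} (hw : w' ∈ cyl w n) {k : ℕ} (hk : k ≤ n) :
    cyl w' k = cyl w k := by
  ext u
  refine forall₂_congr fun i hi => ?_
  rw [hw i (hi.trans_le hk)]

theorem shell_eq_of_mem {w w' : Address} {n : ℕ} (hw : w' ∈ cyl w n) {k : ℕ} (hk : k < n) :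
    shell w' k = shell w k := by
  rw [shell, shell, cyl_eq_of_mem hw hk.le, cyl_eq_of_mem hw hk]

theorem mem_shell_iff {w w' : Address} {k : ℕ} :
    w' ∈ shell w k ↔ w' ∈ cyl w k ∧ w' k ≠ w k := by
  refine and_congr_right fun hk => not_congr ⟨fun hc => hc k k.lt_succ_self, fun e i hi => ?_⟩
  rcases Nat.lt_succ_iff_lt_or_eq.1 hi with hi | rfl
  exacts [hk i hi, e]

theorem exists_mem_shell {w w' : Address} {n : ℕ} (hn : w' ∉ cyl w n) :
    ∃ k < n, w' ∈ shell w k := by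
  induction n with
  | zero => exact absurd (fun i hi => absurd hi (Nat.not_lt_zero i)) hn
  | succ n ih =>
    by_cases hc : w' ∈ cyl w n
    · exact ⟨n, n.lt_succ_self, hc, hn⟩
    · obtain ⟨k, hk, hw⟩ := ih hc
      exact ⟨k, hk.trans n.lt_succ_self, hw⟩

theorem addressMeasure_real_shell_le (w : Address) (k : ℕ) :
    addressMeasure.real (shell w k) ≤ (4 ^ k)⁻¹ :=
  (measureReal_mono Set.sdiff_subset).trans_eq (addressMeasure_real_cyl w k)

/-! ### Separation of the squares -/

theorem abs_coord_le (c : Bool) (z : ℂ) : |coord c z| ≤ ‖z‖ := by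
  cases c
  · simpa [coord] using Complex.abs_im_le_norm z
  · simpa [coord] using Complex.abs_re_le_norm z

theorem coord_sub (c : Bool) (z z' : ℂ) : coord c (z - z') = coord c z - coord c z' := by
  cases c <;> simp [coord]

theorem continuous_coord (c : Bool) : Continuous (coord c) := by
  cases c
  · exact Complex.continuous_im
  · exact Complex.continuous_re

theorem normSq_eq_coord (z : ℂ) : Complex.normSq z = coord true z ^ 2 + coord false z ^ 2 := by
  simp [coord, Complex.normSq_apply, sq]

theorem coord_corner_succ (lam : ℕ → ℝ) (c : Bool) (w : Address) (n : ℕ) :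
    coord c (corner lam w (n + 1)) =
      coord c (corner lam w n) + (side lam n - side lam (n + 1)) * bit (axis c (w n)) := by
  cases c
  · simpa [coord, axis] using corner_im_succ lam w n
  · simpa [coord, axis] using corner_re_succ lam w n

section
variable {lam : ℕ → ℝ} {l : ℝ}

theorem coord_point_mem (hl : l < 1 / 2) (h : ∀ n ≥ 1, 1 / 4 ≤ lam n ∧ lam n ≤ l) (c : Bool)
    (w : Address) (n : ℕ) : coord c (corner lam w n) ≤ coord c (point lam w) ∧
      coord c (point lam w) ≤ coord c (corner lam w n) + side lam n := by
  have := point_mem_square hl h w n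
  simp only [square, Complex.mem_reProdIm, Set.mem_Icc] at this
  cases c
  · simpa [coord] using this.2
  · simpa [coord] using this.1

theorem abs_coord_point_sub_le (hl : l < 1 / 2) (h : ∀ n ≥ 1, 1 / 4 ≤ lam n ∧ lam n ≤ l)
    (c : Bool) {w w' : Address} {n : ℕ} (hw : w' ∈ cyl w n) :
    |coord c (point lam w' - point lam w)| ≤ side lam n := by
  have h1 := coord_point_mem hl h c w n
  have h2 := coord_point_mem hl h c w' n
  rw [corner_congr hw] at h2
  rw [coord_sub, abs_le]
  constructor <;> linarith

theorem norm_point_sub_le (hl : l < 1 / 2) (h : ∀ n ≥ 1, 1 / 4 ≤ lam n ∧ lam n ≤ l)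
    {w w' : Address} {n : ℕ} (hw : w' ∈ cyl w n) :
    ‖point lam w' - point lam w‖ ≤ 2 * side lam n := by
  have h1 := abs_coord_point_sub_le hl h true hw
  have h2 := abs_coord_point_sub_le hl h false hw
  simp only [coord, if_true, Bool.false_eq_true, if_false] at h1 h2
  linarith [Complex.norm_le_abs_re_add_abs_im (point lam w' - point lam w)]

theorem side_succ_le (h : ∀ n ≥ 1, 1 / 4 ≤ lam n ∧ lam n ≤ l) (n : ℕ) :
    side lam (n + 1) ≤ l * side lam n := by
  rw [side_succ, mul_comm l]
  exact mul_le_mul_of_nonneg_left (h (n + 1) (by omega)).2 (side_pos h n).le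

/-- Distinct squares of one generation are separated in a coordinate in which their letters
differ. -/
theorem le_coord_point_sub (hl : l < 1 / 2) (h : ∀ n ≥ 1, 1 / 4 ≤ lam n ∧ lam n ≤ l)
    {c : Bool} {w w' : Address} {k : ℕ} (hw : w' ∈ cyl w k) (h0 : axis c (w k) = false)
    (h1 : axis c (w' k) = true) :
    (1 - 2 * l) * side lam k ≤ coord c (point lam w' - point lam w) := by
  have e1 := (coord_point_mem hl h c w (k + 1)).2
  have e2 := (coord_point_mem hl h c w' (k + 1)).1
  rw [coord_corner_succ, h0, bit] at e1
  rw [coord_corner_succ, h1, bit, corner_congr hw] at e2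
  rw [coord_sub]
  simp only [Bool.false_eq_true, if_false, if_true] at e1 e2
  linarith [side_succ_le h k]

theorem cyl_symm {w w' : Address} {n : ℕ} (hw : w' ∈ cyl w n) : w ∈ cyl w' n :=
  fun i hi => (hw i hi).symm

theorem le_norm_point_sub_of_mem_shell (hl : l < 1 / 2)
    (h : ∀ n ≥ 1, 1 / 4 ≤ lam n ∧ lam n ≤ l) {w w' : Address} {k : ℕ} (hw : w' ∈ shell w k) :
    (1 - 2 * l) * side lam k ≤ ‖point lam w' - point lam w‖ := by
  obtain ⟨hc, hne⟩ := mem_shell_iff.1 hw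
  obtain ⟨c, hcne⟩ : ∃ c, axis c (w k) ≠ axis c (w' k) := by
    by_contra! hall
    exact hne (Prod.ext (by simpa [axis] using (hall true).symm)
      (by simpa [axis] using (hall false).symm))
  rcases Bool.eq_false_or_eq_true (axis c (w k)) with e | e
  · rw [norm_sub_rev]
    refine (le_coord_point_sub hl h (cyl_symm hc) (c := c) ?_ e).trans
      ((le_abs_self _).trans (abs_coord_le c _))
    rw [e] at hcne
    simpa using hcne.symm
  · refine (le_coord_point_sub hl h hc (c := c) e ?_).trans
      ((le_abs_self _).trans (abs_coord_le c _))
    rw [e] at hcne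
    simpa using hcne.symm

theorem side_antitone (hl : l < 1 / 2) (h : ∀ n ≥ 1, 1 / 4 ≤ lam n ∧ lam n ≤ l) :
    Antitone (side lam) :=
  antitone_nat_of_succ_le fun n => by linarith [two_mul_side_lt hl h n, side_pos h (n + 1)]

theorem le_norm_point_sub_of_notMem_cyl (hl : l < 1 / 2)
    (h : ∀ n ≥ 1, 1 / 4 ≤ lam n ∧ lam n ≤ l) {w w' : Address} {n : ℕ} (hw : w' ∉ cyl w (n + 1)) :
    (1 - 2 * l) * side lam n ≤ ‖point lam w' - point lam w‖ := by
  obtain ⟨k, hk, hs⟩ := exists_mem_shell hw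
  refine le_trans ?_ (le_norm_point_sub_of_mem_shell hl h hs)
  exact mul_le_mul_of_nonneg_left (side_antitone hl h (Nat.lt_succ_iff.1 hk)) (by linarith)

theorem side_add_le (h : ∀ n ≥ 1, 1 / 4 ≤ lam n ∧ lam n ≤ l) (hl0 : 0 ≤ l) (n j : ℕ) :
    side lam (n + j) ≤ l ^ j * side lam n := by
  induction j with
  | zero => simp
  | succ j ih =>
    calc side lam (n + j + 1) ≤ l * side lam (n + j) := side_succ_le h _
      _ ≤ l * (l ^ j * side lam n) := mul_le_mul_of_nonneg_left ih hl0
      _ = _ := by ring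

theorem quarter_le (h : ∀ n ≥ 1, 1 / 4 ≤ lam n ∧ lam n ≤ l) : 1 / 4 ≤ l :=
  (h 1 le_rfl).1.trans (h 1 le_rfl).2

/-- If the letters of `w` from `k` up to `n` all vanish in the coordinate `c`, then `w` is at the
lower end of its square of generation `k`, up to an error `side lam n`. -/
theorem neg_side_le_coord_point_sub (hl : l < 1 / 2) (h : ∀ n ≥ 1, 1 / 4 ≤ lam n ∧ lam n ≤ l)
    {c : Bool} {w w' : Address} {k n : ℕ} (hkn : k ≤ n) (hw : w' ∈ cyl w k)
    (h0 : ∀ i, k ≤ i → i < n → axis c (w i) = false) :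
    -side lam n ≤ coord c (point lam w' - point lam w) := by
  have e : coord c (corner lam w n) = coord c (corner lam w k) := by
    induction n, hkn using Nat.le_induction with
    | base => rfl
    | succ n hn ih =>
      rw [coord_corner_succ, h0 n hn n.lt_succ_self,
        ih fun i h1 h2 => h0 i h1 (h2.trans n.lt_succ_self)]
      simp [bit]
  have e1 := (coord_point_mem hl h c w n).2
  have e2 := (coord_point_mem hl h c w' k).1
  rw [corner_congr hw] at e2
  rw [coord_sub]
  linarith

/-! ### Size of the increments -/

theorem kernel_true (z : ℂ) : kernel true z = (1 / z).re := by
  simp [kernel, coord, Complex.inv_re]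

theorem kernel_false (z : ℂ) : kernel false z = -(1 / z).im := by
  simp [kernel, coord, Complex.inv_im, neg_div]

theorem measurable_kernel (c : Bool) : Measurable (kernel c) :=
  (continuous_coord c).measurable.div Complex.continuous_normSq.measurable

theorem abs_kernel_le (c : Bool) (z : ℂ) : |kernel c z| ≤ 1 / ‖z‖ := by
  cases c
  · rw [kernel_false, abs_neg]
    exact (Complex.abs_im_le_norm _).trans_eq (by simp)
  · rw [kernel_true]
    exact (Complex.abs_re_le_norm _).trans_eq (by simp)

theorem abs_kernel_sub_le (c : Bool) {z z' : ℂ} (hz : z ≠ 0) (hz' : z' ≠ 0) :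
    |kernel c z - kernel c z'| ≤ ‖z' - z‖ / (‖z‖ * ‖z'‖) := by
  have e : ‖1 / z - 1 / z'‖ = ‖z' - z‖ / (‖z‖ * ‖z'‖) := by
    rw [div_sub_div _ _ hz hz', norm_div, norm_mul]; simp
  rw [← e]
  cases c
  · rw [kernel_false, kernel_false, ← abs_neg]
    refine le_of_eq_of_le ?_ (Complex.abs_im_le_norm _)
    rw [Complex.sub_im]; ring_nf
  · rw [kernel_true, kernel_true]
    refine le_of_eq_of_le ?_ (Complex.abs_re_le_norm _)
    rw [Complex.sub_re]

theorem measurable_kernel_point (hl : l < 1 / 2) (h : ∀ n ≥ 1, 1 / 4 ≤ lam n ∧ lam n ≤ l)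
    (c : Bool) (w : Address) :
    Measurable fun w' => kernel c (point lam w' - point lam w) :=
  (measurable_kernel c).comp ((continuous_point hl h).sub continuous_const).measurable

theorem gap_pos (hl : l < 1 / 2) (h : ∀ n ≥ 1, 1 / 4 ≤ lam n ∧ lam n ≤ l) (k : ℕ) :
    0 < (1 - 2 * l) * side lam k :=
  mul_pos (by linarith) (side_pos h k)

theorem abs_kernel_le_of_mem_shell (hl : l < 1 / 2) (h : ∀ n ≥ 1, 1 / 4 ≤ lam n ∧ lam n ≤ l)
    (c : Bool) {w w' : Address} {k : ℕ} (hw : w' ∈ shell w k) :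
    |kernel c (point lam w' - point lam w)| ≤ 1 / ((1 - 2 * l) * side lam k) :=
  (abs_kernel_le c _).trans
    (one_div_le_one_div_of_le (gap_pos hl h k) (le_norm_point_sub_of_mem_shell hl h hw))

theorem integrableOn_kernel (hl : l < 1 / 2) (h : ∀ n ≥ 1, 1 / 4 ≤ lam n ∧ lam n ≤ l)
    (c : Bool) (w : Address) (k : ℕ) :
    IntegrableOn (fun w' => kernel c (point lam w' - point lam w)) (shell w k) addressMeasure := by
  refine Measure.integrableOn_of_bounded (M := 1 / ((1 - 2 * l) * side lam k))
    (measure_ne_top _ _) (measurable_kernel_point hl h c w).aestronglyMeasurable ?_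
  filter_upwards [ae_restrict_mem (measurableSet_shell w k)] with w' hw'
  exact abs_kernel_le_of_mem_shell hl h c hw'

theorem density_pos (h : ∀ n ≥ 1, 1 / 4 ≤ lam n ∧ lam n ≤ l) (n : ℕ) : 0 < density lam n := by
  have := side_pos h n
  unfold density; positivity

theorem density_antitone (h : ∀ n ≥ 1, 1 / 4 ≤ lam n ∧ lam n ≤ l) : Antitone (density lam) := by
  refine antitone_nat_of_succ_le fun n => ?_
  have h1 := side_pos h n
  have h2 := (h (n + 1) (by omega)).1
  unfold density
  rw [side_succ]
  refine one_div_le_one_div_of_le (by positivity) ?_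
  rw [pow_succ]
  have : 0 < 4 ^ n * side lam n := by positivity
  nlinarith

theorem inv_four_pow_eq (h : ∀ n ≥ 1, 1 / 4 ≤ lam n ∧ lam n ≤ l) (n : ℕ) :
    ((4 : ℝ) ^ n)⁻¹ = density lam n * side lam n := by
  have h1 := side_pos h n
  unfold density
  field_simp

theorem abs_increment_le (hl : l < 1 / 2) (h : ∀ n ≥ 1, 1 / 4 ≤ lam n ∧ lam n ≤ l)
    (c : Bool) (w : Address) (k : ℕ) :
    |increment lam c k w| ≤ density lam k / (1 - 2 * l) := by
  have h1 := side_pos h k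
  have h2 : 0 < 1 - 2 * l := by linarith
  have := norm_setIntegral_le_of_norm_le_const (μ := addressMeasure) (s := shell w k)
    (f := fun w' => kernel c (point lam w' - point lam w))
    (C := 1 / ((1 - 2 * l) * side lam k)) (measure_lt_top _ _)
    (fun w' hw' => abs_kernel_le_of_mem_shell hl h c hw')
  refine this.trans ?_
  calc _ ≤ 1 / ((1 - 2 * l) * side lam k) * (4 ^ k)⁻¹ :=
        mul_le_mul_of_nonneg_left (addressMeasure_real_shell_le w k) (by positivity)
    _ = _ := by unfold density; field_simp

theorem abs_increment_sub_le (hl : l < 1 / 2) (h : ∀ n ≥ 1, 1 / 4 ≤ lam n ∧ lam n ≤ l)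
    (c : Bool) {w w' : Address} {k n : ℕ} (hk : k < n) (hw : w' ∈ cyl w n) :
    |increment lam c k w' - increment lam c k w| ≤
      2 * side lam n / ((1 - 2 * l) * side lam k) ^ 2 * (4 ^ k)⁻¹ := by
  have hg := gap_pos hl h k
  have hs := side_pos h n
  unfold increment
  rw [shell_eq_of_mem hw hk,
    ← integral_sub (shell_eq_of_mem hw hk ▸ integrableOn_kernel hl h c w' k)
    (integrableOn_kernel hl h c w k)]
  refine (norm_setIntegral_le_of_norm_le_const (μ := addressMeasure) (s := shell w k)
    (f := fun u => kernel c (point lam u - point lam w') - kernel c (point lam u - point lam w))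
    (C := 2 * side lam n / ((1 - 2 * l) * side lam k) ^ 2) (measure_lt_top _ _) ?_).trans
    (mul_le_mul_of_nonneg_left (addressMeasure_real_shell_le w k) (by positivity))
  intro u hu
  have n1 := le_norm_point_sub_of_mem_shell hl h hu
  have n2 := le_norm_point_sub_of_mem_shell hl h (shell_eq_of_mem hw hk ▸ hu)
  have p1 := hg.trans_le n1
  have p2 := hg.trans_le n2
  refine (abs_kernel_sub_le c (norm_pos_iff.1 p2) (norm_pos_iff.1 p1)).trans ?_
  have e : point lam u - point lam w - (point lam u - point lam w') =
    point lam w' - point lam w := by ring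
  rw [e, sq]
  exact div_le_div₀ (by positivity) (norm_point_sub_le hl h hw) (by positivity)
    (mul_le_mul n2 n1 hg.le p2.le)

/-- The accumulated integral over the first `n` shells. -/
noncomputable def partialSum (lam : ℕ → ℝ) (c : Bool) (n : ℕ) (w : Address) : ℝ :=
  ∑ k ∈ Finset.range n, increment lam c k w

/-- A bound for the oscillation of the `n`-th partial sum on a square of generation `n`, relative
to the density. -/
noncomputable def oscConst (l : ℝ) : ℝ := 2 / ((1 - 2 * l) ^ 2 * (1 - 4 * l ^ 2))

/-- The oscillation of the `n`-th partial sum on a square of generation `n` is comparable to the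
density: the contribution of generation `n - j` is smaller by the factor `(4 * l ^ 2) ^ j`. -/
theorem abs_partialSum_sub_le (hl : l < 1 / 2) (h : ∀ n ≥ 1, 1 / 4 ≤ lam n ∧ lam n ≤ l)
    (c : Bool) {w w' : Address} {n : ℕ} (hw : w' ∈ cyl w n) :
    |partialSum lam c n w' - partialSum lam c n w| ≤
      oscConst l * density lam n := by
  have hl0 : 0 < l := by linarith [quarter_le h]
  have hd : 0 < 1 - 2 * l := by linarith
  have hq : 0 < 1 - 4 * l ^ 2 := by nlinarith
  have han := density_pos h n
  have key : ∀ k ∈ Finset.range n, |increment lam c k w' - increment lam c k w| ≤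
      2 / (1 - 2 * l) ^ 2 * density lam n * (4 * l ^ 2) ^ (n - k) := by
    intro k hk
    have hk := Finset.mem_range.1 hk
    refine (abs_increment_sub_le hl h c hk hw).trans ?_
    have hsk := side_pos h k
    have hsn := side_pos h n
    have hle := side_add_le h hl0.le k (n - k)
    rw [Nat.add_sub_cancel' hk.le] at hle
    have e4 : (4 : ℝ) ^ n = 4 ^ k * 4 ^ (n - k) := by rw [← pow_add, Nat.add_sub_cancel' hk.le]
    have hsq : side lam n ^ 2 ≤ (l ^ (n - k) * side lam k) ^ 2 :=
      pow_le_pow_left₀ hsn.le hle 2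
    have hm : 2 * side lam n / ((1 - 2 * l) * side lam k) ^ 2 * (4 ^ k)⁻¹ =
        2 / (1 - 2 * l) ^ 2 * density lam n *
          (4 ^ (n - k) * (side lam n ^ 2 / side lam k ^ 2)) := by
      unfold density
      rw [e4]
      field_simp
    rw [hm]
    refine mul_le_mul_of_nonneg_left ?_ (by positivity)
    rw [mul_pow 4 (l ^ 2)]
    refine mul_le_mul_of_nonneg_left ?_ (by positivity)
    rw [div_le_iff₀ (by positivity)]
    calc _ ≤ _ := hsq
      _ = _ := by ring
  unfold partialSum
  rw [← Finset.sum_sub_distrib]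
  refine (Finset.abs_sum_le_sum_abs _ _).trans ((Finset.sum_le_sum key).trans ?_)
  rw [← Finset.mul_sum]
  have hgeo : ∑ k ∈ Finset.range n, (4 * l ^ 2) ^ (n - k) ≤ (1 - 4 * l ^ 2)⁻¹ := by
    rw [← Finset.sum_range_reflect]
    calc _ ≤ ∑ k ∈ Finset.range n, (4 * l ^ 2) ^ k := by
          refine Finset.sum_le_sum fun k hk => pow_le_pow_of_le_one (by positivity) (by linarith) ?_
          have := Finset.mem_range.1 hk
          omega
      _ ≤ ∑' k, (4 * l ^ 2) ^ k :=
        (summable_geometric_of_lt_one (by positivity) (by linarith)).sum_le_tsum _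
          fun _ _ => by positivity
      _ = _ := tsum_geometric_of_lt_one (by positivity) (by linarith)
  refine (mul_le_mul_of_nonneg_left hgeo (by positivity)).trans_eq ?_
  unfold oscConst
  field_simp

/-! ### Reflections and constant stretches -/

theorem axis_flipFrom (c : Bool) {n : ℕ} (g : Bool × Bool) (w : Address) {i : ℕ} (hi : n ≤ i) :
    axis c (flipFrom n g w i) = xor (axis c (w i)) (axis c g) := by
  cases c <;> simp [axis, flipFrom, hi.not_gt]

theorem flipFrom_of_lt {n : ℕ} (g : Bool × Bool) (w : Address) {i : ℕ} (hi : i < n) :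
    flipFrom n g w i = w i := by simp [flipFrom, hi]

theorem flipFrom_eq_iff {n : ℕ} (g : Bool × Bool) (w w' : Address) (i : ℕ) :
    flipFrom n g w' i = flipFrom n g w i ↔ w' i = w i := by
  by_cases hi : i < n <;> simp [flipFrom, hi, Prod.ext_iff]

theorem flipFrom_mem_cyl_iff {n : ℕ} (g : Bool × Bool) (w w' : Address) (k : ℕ) :
    flipFrom n g w' ∈ cyl (flipFrom n g w) k ↔ w' ∈ cyl w k :=
  forall₂_congr fun i _ => flipFrom_eq_iff g w w' i

theorem bit_xor_sub (a b g : Bool) : bit (xor a g) - bit (xor b g) = sgn g * (bit a - bit b) := by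
  cases a <;> cases b <;> cases g <;> simp [bit, sgn]

theorem coord_point_flipFrom_sub (hl : l < 1 / 2) (h : ∀ n ≥ 1, 1 / 4 ≤ lam n ∧ lam n ≤ l)
    (c : Bool) {n : ℕ} (g : Bool × Bool) {w w' : Address} (hw : w' ∈ cyl w n) :
    coord c (point lam (flipFrom n g w') - point lam (flipFrom n g w)) =
      sgn (axis c g) * coord c (point lam w' - point lam w) := by
  have fin : ∀ m, coord c (corner lam (flipFrom n g w') m) -
      coord c (corner lam (flipFrom n g w) m) =
      sgn (axis c g) * (coord c (corner lam w' m) - coord c (corner lam w m)) := by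
    intro m
    induction m with
    | zero => simp [corner]
    | succ m ih =>
      simp only [coord_corner_succ]
      by_cases hm : m < n
      · rw [flipFrom_of_lt g w hm, flipFrom_of_lt g w' hm, hw m hm]
        linarith
      · rw [axis_flipFrom c g w (not_lt.1 hm), axis_flipFrom c g w' (not_lt.1 hm)]
        have := bit_xor_sub (axis c (w' m)) (axis c (w m)) (axis c g)
        linear_combination ih + (side lam m - side lam (m + 1)) * this
  have lim : ∀ u, Tendsto (fun m => coord c (corner lam u m)) atTop (𝓝 (coord c (point lam u))) :=
    fun u => ((continuous_coord c).tendsto _).comp (tendsto_corner hl h u)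
  rw [coord_sub, coord_sub]
  refine tendsto_nhds_unique ((lim _).sub (lim _)) ?_
  simp only [fin]
  exact ((lim _).sub (lim _)).const_mul _

theorem sgn_sq (b : Bool) : sgn b ^ 2 = 1 := by cases b <;> simp [sgn]

theorem kernel_point_flipFrom_sub (hl : l < 1 / 2) (h : ∀ n ≥ 1, 1 / 4 ≤ lam n ∧ lam n ≤ l)
    (c : Bool) {n : ℕ} (g : Bool × Bool) {w w' : Address} (hw : w' ∈ cyl w n) :
    kernel c (point lam (flipFrom n g w') - point lam (flipFrom n g w)) =
      sgn (axis c g) * kernel c (point lam w' - point lam w) := by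
  unfold kernel
  rw [normSq_eq_coord, normSq_eq_coord, coord_point_flipFrom_sub hl h true g hw,
    coord_point_flipFrom_sub hl h false g hw, coord_point_flipFrom_sub hl h c g hw,
    mul_pow, mul_pow, sgn_sq, sgn_sq, one_mul, one_mul, mul_div_assoc]

theorem measurePreserving_flipFrom (n : ℕ) (g : Bool × Bool) :
    MeasurePreserving (flipFrom n g) addressMeasure addressMeasure := by
  let f : ℕ → Bool × Bool → Bool × Bool := fun i v =>
    if i < n then v else (xor v.1 g.1, xor v.2 g.2)
  have hf : ∀ i, Measurable (f i) := fun i => measurable_of_countable _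
  have hinv : ∀ i, Function.Involutive (f i) := fun i v => by
    by_cases hi : i < n <;> simp [f, hi]
  have e : flipFrom n g = fun (w : Address) i => f i (w i) := rfl
  refine ⟨?_, ?_⟩
  · rw [e]; exact measurable_pi_lambda _ fun i => (hf i).comp (measurable_pi_apply i)
  · rw [e, addressMeasure, Measure.infinitePi_map_pi _ hf]
    congr 1
    ext1 i
    refine Measure.ext_of_singleton fun v => ?_
    rw [Measure.map_apply (hf i) (measurableSet_singleton _)]
    have : f i ⁻¹' {v} = {f i v} := by
      ext u
      simp only [Set.mem_preimage, Set.mem_singleton_iff]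
      exact ⟨fun hu => by rw [← hu, hinv i u], fun hu => by rw [hu, hinv i v]⟩
    rw [this, letterMeasure_singleton, letterMeasure_singleton]

theorem increment_flipFrom (hl : l < 1 / 2) (h : ∀ n ≥ 1, 1 / 4 ≤ lam n ∧ lam n ≤ l)
    (c : Bool) {n k : ℕ} (hk : n ≤ k) (g : Bool × Bool) (w : Address) :
    increment lam c k (flipFrom n g w) = sgn (axis c g) * increment lam c k w := by
  have hp := measurePreserving_flipFrom n g
  unfold increment
  conv_lhs => rw [← hp.map_eq]
  rw [setIntegral_map (measurableSet_shell _ _)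
    (measurable_kernel_point hl h c _).aestronglyMeasurable hp.measurable.aemeasurable,
    ← integral_const_mul]
  have : flipFrom n g ⁻¹' shell (flipFrom n g w) k = shell w k := by
    ext u
    simp only [shell, Set.preimage_sdiff, Set.mem_sdiff, Set.mem_preimage, flipFrom_mem_cyl_iff]
  rw [this]
  refine setIntegral_congr_fun (measurableSet_shell _ _) fun u hu => ?_
  exact kernel_point_flipFrom_sub hl h c g (cyl_antitone w hk hu.1)

/-- While the letters of `w` stay constant, the increments have a definite sign and size: most of
the mass of the shell lies on one side of `point lam w`. -/
theorem le_sgn_mul_increment (hl : l < 1 / 2) (h : ∀ n ≥ 1, 1 / 4 ≤ lam n ∧ lam n ≤ l)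
    (c : Bool) {r : ℕ} (hr : l ^ r ≤ (1 - 2 * l) ^ 3 / 16) {k n : ℕ} (hk : k + r ≤ n)
    {v : Bool × Bool} {w : Address} (hw : ∀ i, k ≤ i → i < n → w i = v) (hkn : k < n) :
    (1 - 2 * l) / 16 * density lam k ≤ sgn (axis c v) * increment lam c k w := by
  have hl0 : 0 < l := by linarith [quarter_le h]
  have hd : 0 < 1 - 2 * l := by linarith
  have hsk := side_pos h k
  have hsn := side_pos h n
  have hg := gap_pos hl h k
  -- reflect so that the constant letter becomes the lower left corner
  rw [← increment_flipFrom hl h c le_rfl v w]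
  set u := flipFrom k v w with hu
  have hu0 : ∀ c i, k ≤ i → i < n → axis c (u i) = false := fun c i h1 h2 => by
    rw [hu, axis_flipFrom c v w h1, hw i h1 h2, Bool.xor_self]
  have hside : side lam n ≤ (1 - 2 * l) ^ 3 / 16 * side lam k :=
    calc side lam n ≤ side lam (k + r) := side_antitone hl h hk
      _ ≤ l ^ r * side lam k := side_add_le h hl0.le k r
      _ ≤ _ := mul_le_mul_of_nonneg_right hr hsk.le
  -- the square of generation `k + 1` that is opposite to that of `u` carries a quarter of the mass
  let u' : Address := Function.update u k (true, true)
  have hsub : cyl u' (k + 1) ⊆ shell u k := by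
    intro x hx
    refine mem_shell_iff.2 ⟨fun i hi => ?_, fun e => ?_⟩
    · rw [hx i (hi.trans k.lt_succ_self)]; exact Function.update_of_ne hi.ne _ _
    · have h1 := hx k k.lt_succ_self
      have h2 := hu0 true k le_rfl hkn
      rw [← e, h1] at h2
      simp [u', axis] at h2
  have hlow : ∀ x ∈ shell u k, -((1 - 2 * l) / (16 * side lam k)) ≤
      kernel c (point lam x - point lam u) := by
    intro x hx
    have h1 := neg_side_le_coord_point_sub hl h (by omega) hx.1 (hu0 c)
    have h2 := le_norm_point_sub_of_mem_shell hl h hx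
    have h3 : ((1 - 2 * l) * side lam k) ^ 2 ≤ Complex.normSq (point lam x - point lam u) := by
      rw [Complex.normSq_eq_norm_sq]; exact pow_le_pow_left₀ hg.le h2 2
    have h5 : 0 < Complex.normSq (point lam x - point lam u) := lt_of_lt_of_le (by positivity) h3
    rw [kernel, ← neg_div, div_le_div_iff₀ (by positivity) h5]
    nlinarith
  have hhigh : ∀ x ∈ cyl u' (k + 1), (1 - 2 * l) / (2 * side lam k) ≤
      kernel c (point lam x - point lam u) := by
    intro x hx
    have h0 := (hsub hx).1
    have h1 : (1 - 2 * l) * side lam k ≤ coord c (point lam x - point lam u) := by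
      refine le_coord_point_sub hl h h0 (hu0 c k le_rfl hkn) ?_
      rw [hx k k.lt_succ_self]
      cases c <;> simp [u', axis]
    have h2 := abs_le.1 (abs_coord_point_sub_le hl h true h0)
    have h3 := abs_le.1 (abs_coord_point_sub_le hl h false h0)
    have h4 := (hg.trans_le ((le_norm_point_sub_of_mem_shell hl h (hsub hx))))
    have h5 : 0 < Complex.normSq (point lam x - point lam u) :=
      Complex.normSq_pos.2 (norm_pos_iff.1 h4)
    rw [kernel, div_le_div_iff₀ (by positivity) h5]
    have h6 : Complex.normSq (point lam x - point lam u) ≤ 2 * side lam k ^ 2 := by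
      rw [normSq_eq_coord]; nlinarith
    nlinarith
  have hint := integrableOn_kernel hl h c u k
  set b : ℝ := (1 - 2 * l) / (16 * side lam k) with hb
  have hb0 : 0 < b := by positivity
  have hintb : IntegrableOn (fun x => kernel c (point lam x - point lam u) + b) (shell u k)
      addressMeasure := hint.add (integrableOn_const (measure_ne_top _ _))
  have i1 : ∫ x in shell u k, (kernel c (point lam x - point lam u) + b) ∂addressMeasure =
      increment lam c k u + b * addressMeasure.real (shell u k) := by
    rw [integral_add hint (integrableOn_const (measure_ne_top _ _)), setIntegral_const, smul_eq_mul,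
      mul_comm b, increment]
  have i2 : ∫ x in cyl u' (k + 1), (kernel c (point lam x - point lam u) + b) ∂addressMeasure ≤
      ∫ x in shell u k, (kernel c (point lam x - point lam u) + b) ∂addressMeasure := by
    refine setIntegral_mono_set hintb ?_ hsub.eventuallyLE
    filter_upwards [ae_restrict_mem (measurableSet_shell u k)] with x hx
    have := hlow x hx
    simp only [Pi.zero_apply]
    linarith
  have i3 := setIntegral_ge_of_const_le_real (measurableSet_cyl u' (k + 1)) (measure_ne_top _ _)
    (fun x hx => (hhigh x hx).trans (le_add_of_nonneg_right hb0.le)) (hintb.mono_set hsub)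
  rw [addressMeasure_real_cyl] at i3
  have i4 := mul_le_mul_of_nonneg_left (addressMeasure_real_shell_le u k) hb0.le
  have e1 : b * (4 ^ k)⁻¹ = (1 - 2 * l) / 16 * density lam k := by
    rw [hb]; unfold density; field_simp
  have e2 : (1 - 2 * l) / (2 * side lam k) * (4 ^ (k + 1))⁻¹ =
      2 * ((1 - 2 * l) / 16 * density lam k) := by
    unfold density; rw [pow_succ]; field_simp; norm_num
  linarith

end

/-! ### From partial sums to principal values -/
section
variable {lam : ℕ → ℝ} {l : ℝ}

theorem integrableOn_cauchy (hl : l < 1 / 2) (h : ∀ n ≥ 1, 1 / 4 ≤ lam n ∧ lam n ≤ l)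
    (w : Address) (n : ℕ) :
    IntegrableOn (fun w' => 1 / (point lam w' - point lam w)) (cyl w (n + 1))ᶜ
      addressMeasure := by
  refine Measure.integrableOn_of_bounded (M := 1 / ((1 - 2 * l) * side lam n))
    (measure_ne_top _ _) ?_ ?_
  · exact (measurable_const.div
      ((continuous_point hl h).sub continuous_const).measurable).aestronglyMeasurable
  · filter_upwards [ae_restrict_mem (measurableSet_cyl w (n + 1)).compl] with w' hw'
    rw [norm_div, norm_one]
    exact one_div_le_one_div_of_le (gap_pos hl h n) (le_norm_point_sub_of_notMem_cyl hl h hw')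

theorem setIntegral_shell_cauchy (hl : l < 1 / 2) (h : ∀ n ≥ 1, 1 / 4 ≤ lam n ∧ lam n ≤ l)
    (w : Address) (n : ℕ) :
    ∫ w' in shell w n, 1 / (point lam w' - point lam w) ∂addressMeasure =
      ⟨increment lam true n w, -increment lam false n w⟩ := by
  have hint : IntegrableOn (fun w' => 1 / (point lam w' - point lam w)) (shell w n)
      addressMeasure := (integrableOn_cauchy hl h w n).mono_set fun _ hx => hx.2
  refine Complex.ext ?_ ?_
  · refine (Complex.reCLM.integral_comp_comm hint).symm.trans ?_
    simp only [Complex.reCLM_apply, ← kernel_true, increment]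
  · refine (Complex.imCLM.integral_comp_comm hint).symm.trans ?_
    simp only [increment, kernel_false, integral_neg, neg_neg, Complex.imCLM_apply]

theorem setIntegral_compl_cyl (hl : l < 1 / 2) (h : ∀ n ≥ 1, 1 / 4 ≤ lam n ∧ lam n ≤ l)
    (w : Address) (n : ℕ) :
    ∫ w' in (cyl w n)ᶜ, 1 / (point lam w' - point lam w) ∂addressMeasure =
      ⟨partialSum lam true n w, -partialSum lam false n w⟩ := by
  induction n with
  | zero =>
    have : (cyl w 0)ᶜ = ∅ := by ext; simp [cyl]
    rw [this]
    simp [partialSum, Complex.ext_iff]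
  | succ n ih =>
    have e : (cyl w (n + 1))ᶜ = (cyl w n)ᶜ ∪ shell w n := by
      ext u
      have := @cyl_antitone w n (n + 1) n.le_succ u
      simp only [shell, Set.mem_compl_iff, Set.mem_union, Set.mem_sdiff]
      tauto
    have hint := integrableOn_cauchy hl h w n
    rw [e] at hint ⊢
    have hdisj : Disjoint (cyl w n)ᶜ (shell w n) :=
      disjoint_compl_left.mono_right Set.sdiff_subset
    rw [setIntegral_union hdisj (measurableSet_shell w n)
      hint.left_of_union hint.right_of_union, ih, setIntegral_shell_cauchy hl h]
    simp only [partialSum, Finset.sum_range_succ, Complex.ext_iff, Complex.add_re, Complex.add_im,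
      true_and]
    ring

theorem tendsto_side (hl : l < 1 / 2) (h : ∀ n ≥ 1, 1 / 4 ≤ lam n ∧ lam n ≤ l) :
    Tendsto (side lam) atTop (𝓝 0) := by
  have hl0 : 0 < l := by linarith [quarter_le h]
  refine squeeze_zero (fun n => (side_pos h n).le) (fun n => ?_)
    (tendsto_pow_atTop_nhds_zero_of_lt_one hl0.le (by linarith))
  simpa [side] using side_add_le h hl0.le 0 n

/-- Truncating at distance `ε` and removing the square of generation `n + 1` give nearly the same
integral if `ε` lies between the scales of the generations `n + 1` and `n`. -/
theorem norm_truncated_sub_le (hl : l < 1 / 2) (h : ∀ n ≥ 1, 1 / 4 ≤ lam n ∧ lam n ≤ l)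
    {q : ℕ} (hq : 2 * l ^ q < 1 - 2 * l) (w : Address) {n : ℕ} (hn : q ≤ n) {ε : ℝ}
    (h1 : 2 * side lam (n + 1) ≤ ε) (h2 : ε < 2 * side lam n) :
    ‖∫ w' in (cyl w (n + 1))ᶜ, 1 / (point lam w' - point lam w) ∂addressMeasure -
      ∫ w' in {w' | ε < ‖point lam w' - point lam w‖},
        1 / (point lam w' - point lam w) ∂addressMeasure‖ ≤
      4 ^ q / (1 - 2 * l) * density lam n := by
  have hl0 : 0 < l := by linarith [quarter_le h]
  have hd : 0 < 1 - 2 * l := by linarith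
  have hsn := side_pos h n
  have hsub : {w' | ε < ‖point lam w' - point lam w‖} ⊆ (cyl w (n + 1))ᶜ := fun w' hw' hc =>
    absurd (norm_point_sub_le hl h hc) (not_le.2 (h1.trans_lt hw'))
  have hmeas : MeasurableSet {w' | ε < ‖point lam w' - point lam w‖} :=
    (isOpen_lt continuous_const ((continuous_point hl h).sub continuous_const).norm).measurableSet
  rw [← setIntegral_sdiff hmeas (integrableOn_cauchy hl h w n) hsub]
  have hsub' : (cyl w (n + 1))ᶜ \ {w' | ε < ‖point lam w' - point lam w‖} ⊆ cyl w (n - q) := by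
    rintro u ⟨-, hu⟩
    by_contra hc
    obtain ⟨k, hk, hks⟩ := exists_mem_shell hc
    have e1 := le_norm_point_sub_of_mem_shell hl h hks
    have e2 := side_antitone hl h (show k + q ≤ n by omega)
    have e3 := side_add_le h hl0.le k q
    have e4 := side_pos h k
    simp only [Set.mem_ofPred_eq, not_lt] at hu
    nlinarith
  refine (norm_setIntegral_le_of_norm_le_const (C := 1 / ((1 - 2 * l) * side lam n))
    (measure_lt_top _ _) fun u hu => ?_).trans ?_
  · rw [norm_div, norm_one]
    exact one_div_le_one_div_of_le (gap_pos hl h n) (le_norm_point_sub_of_notMem_cyl hl h hu.1)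
  · have := measureReal_mono (μ := addressMeasure) hsub'
    rw [addressMeasure_real_cyl] at this
    refine (mul_le_mul_of_nonneg_left this (by positivity)).trans_eq ?_
    have e4 : (4 : ℝ) ^ n = 4 ^ (n - q) * 4 ^ q := by rw [← pow_add, Nat.sub_add_cancel hn]
    unfold density
    rw [e4]
    field_simp

theorem hasPrincipalValue_of_tendsto (hl : l < 1 / 2) (h : ∀ n ≥ 1, 1 / 4 ≤ lam n ∧ lam n ≤ l)
    (ha : Tendsto (density lam) atTop (𝓝 0)) {w : Address} {L : Bool → ℝ}
    (hL : ∀ c, Tendsto (fun n => partialSum lam c n w) atTop (𝓝 (L c))) :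
    HasPrincipalValue (cantorMeasure lam) (point lam w) ⟨L true, -L false⟩ := by
  have hl0 : 0 < l := by linarith [quarter_le h]
  have hd : 0 < 1 - 2 * l := by linarith
  obtain ⟨q, hq⟩ := exists_pow_lt_of_lt_one (show 0 < (1 - 2 * l) / 2 by linarith)
    (show l < 1 by linarith)
  have hT : Tendsto (fun n => ∫ w' in (cyl w (n + 1))ᶜ,
      1 / (point lam w' - point lam w) ∂addressMeasure) atTop (𝓝 ⟨L true, -L false⟩) := by
    have e : ∀ x y : ℝ, (⟨x, -y⟩ : ℂ) = x - y * Complex.I := fun x y => by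
      simp [Complex.ext_iff]
    simp only [setIntegral_compl_cyl hl h, e]
    exact (((Complex.continuous_ofReal.tendsto _).comp (hL true)).sub
      (((Complex.continuous_ofReal.tendsto _).comp (hL false)).mul_const Complex.I)).comp
      (tendsto_add_atTop_nat 1)
  have hA : Tendsto (fun n => 4 ^ q / (1 - 2 * l) * density lam n) atTop (𝓝 0) := by
    simpa using ha.const_mul (4 ^ q / (1 - 2 * l))
  have hI : ∀ ε : ℝ, ∫ z in {z : ℂ | ε < ‖z - point lam w‖}, 1 / (z - point lam w)
      ∂(cantorMeasure lam) = ∫ w' in {w' | ε < ‖point lam w' - point lam w‖},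
        1 / (point lam w' - point lam w) ∂addressMeasure := fun ε => by
    have hs : MeasurableSet {z : ℂ | ε < ‖z - point lam w‖} :=
      (isOpen_lt continuous_const (by fun_prop)).measurableSet
    have hf : Measurable fun z : ℂ => 1 / (z - point lam w) := by fun_prop
    exact setIntegral_map hs hf.aestronglyMeasurable (continuous_point hl h).measurable.aemeasurable
  unfold HasPrincipalValue
  simp only [hI]
  rw [Metric.tendsto_nhds]
  intro η hη
  obtain ⟨n₁, hn₁⟩ := Metric.tendsto_atTop.1 hT (η / 2) (by linarith)
  obtain ⟨n₂, hn₂⟩ := Metric.tendsto_atTop.1 hA (η / 2) (by linarith)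
  set n₀ := max q (max n₁ n₂)
  filter_upwards [Ioo_mem_nhdsGT (show (0 : ℝ) < 2 * side lam n₀ by linarith [side_pos h n₀])]
    with ε hε
  have hex : ∃ m, 2 * side lam m ≤ ε := by
    have := (tendsto_side hl h).const_mul 2
    rw [mul_zero] at this
    obtain ⟨m, hm⟩ := (this.eventually_le_const hε.1).exists
    exact ⟨m, hm⟩
  classical
  obtain ⟨n, hn⟩ : ∃ n, Nat.find hex = n + 1 := by
    refine Nat.exists_eq_succ_of_ne_zero fun e => ?_
    have h0 := Nat.find_spec hex
    rw [e] at h0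
    linarith [side_antitone hl h (Nat.zero_le n₀), hε.2]
  have e1 : 2 * side lam (n + 1) ≤ ε := hn ▸ Nat.find_spec hex
  have e2 : ε < 2 * side lam n := not_le.1 (Nat.find_min hex (by omega))
  have hn0 : n₀ ≤ n := by
    by_contra! hlt
    linarith [side_antitone hl h (show n + 1 ≤ n₀ from hlt), hε.2]
  have hqn : q ≤ n := (le_max_left _ _).trans hn0
  have b1 := hn₁ n ((le_max_left _ _).trans ((le_max_right q _).trans hn0))
  have b2 := hn₂ n ((le_max_right _ _).trans ((le_max_right q _).trans hn0))
  have b3 := norm_truncated_sub_le hl h (by linarith) w hqn e1 e2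
  rw [dist_zero_right] at b2
  rw [← dist_eq_norm, dist_comm] at b3
  linarith [dist_triangle (∫ w' in {w' | ε < ‖point lam w' - point lam w‖},
        1 / (point lam w' - point lam w) ∂addressMeasure) (∫ w' in (cyl w (n + 1))ᶜ,
      1 / (point lam w' - point lam w) ∂addressMeasure) ⟨L true, -L false⟩,
    le_abs_self (4 ^ q / (1 - 2 * l) * density lam n),
    Real.norm_eq_abs (4 ^ q / (1 - 2 * l) * density lam n)]

end


/-! ### Steering -/

/-- A real sequence with increments `O(a n)`, where `a` decreases to zero, converges if at the end
of each block of `N` steps over which `a` at most halves, its modulus has dropped by `a` or is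
`O(a)`. The reason is that `|t| + B * a` also drops over the remaining blocks when `B` is large: so
either `∑ a` is finite along the blocks, or `t` tends to zero. -/
theorem exists_tendsto_of_block_decrease {a t : ℕ → ℝ} {C R : ℝ} {N : ℕ} (hN : 0 < N)
    (ha : Antitone a) (ha0 : ∀ n, 0 < a n) (hlim : Tendsto a atTop (𝓝 0)) (hC : 0 ≤ C)
    (ht : ∀ n, |t (n + 1) - t n| ≤ C * a n)
    (hblock : ∀ j, a (j * N) ≤ 2 * a ((j + 1) * N) →
      |t ((j + 1) * N)| ≤ |t (j * N)| - a (j * N) ∨ |t ((j + 1) * N)| ≤ R * a (j * N)) :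
    ∃ L, Tendsto t atTop (𝓝 L) := by
  have hstep : ∀ n i, |t (n + i) - t n| ≤ C * i * a n := by
    intro n i
    induction i with
    | zero => simp
    | succ i ih =>
      have h1 := (ht (n + i)).trans (mul_le_mul_of_nonneg_left (ha (n.le_add_right i)) hC)
      have h2 := abs_add_le (t (n + i + 1) - t (n + i)) (t (n + i) - t n)
      rw [sub_add_sub_cancel] at h2
      rw [← add_assoc, Nat.cast_succ]
      linarith
  have hmul : Tendsto (fun j => j * N) atTop atTop :=
    tendsto_id.atTop_mul_const' hN
  have hb : Tendsto (fun j => a (j * N)) atTop (𝓝 0) := hlim.comp hmul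
  -- the values at the ends of the blocks determine the limit
  suffices hs : ∃ L, Tendsto (fun j => t (j * N)) atTop (𝓝 L) by
    obtain ⟨L, hL⟩ := hs
    refine ⟨L, ?_⟩
    have hdiv : Tendsto (fun n => n / N) atTop atTop := Nat.tendsto_div_const_atTop hN.ne'
    have h1 : Tendsto (fun n => t n - t (n / N * N)) atTop (𝓝 0) := by
      have h2 : Tendsto (fun n => C * N * a (n / N * N)) atTop (𝓝 0) := by
        simpa using (hb.comp hdiv).const_mul (C * N)
      refine squeeze_zero_norm (fun n => ?_) h2
      have h3 := hstep (n / N * N) (n % N)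
      rw [Nat.div_add_mod'] at h3
      refine h3.trans (mul_le_mul_of_nonneg_right (mul_le_mul_of_nonneg_left ?_ hC) (ha0 _).le)
      exact_mod_cast (Nat.mod_lt n hN).le
    simpa using h1.add (hL.comp hdiv)
  have hstepN : ∀ j, |t ((j + 1) * N) - t (j * N)| ≤ C * N * a (j * N) := fun j => by
    rw [Nat.succ_mul]; exact hstep _ _
  by_cases hsum : Summable fun j => a (j * N)
  · refine cauchySeq_tendsto_of_complete
      (cauchySeq_of_dist_le_of_summable (fun j => C * N * a (j * N)) (fun j => ?_)
        (hsum.mul_left _))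
    rw [dist_comm]
    exact hstepN j
  · refine ⟨0, ?_⟩
    -- `B` is so large that over a block on which `a` halves, `B * a` drops by more than `|t|` grows
    set B : ℝ := 2 * (C * N + 1) with hB
    have hB0 : 0 < B := by positivity
    set V : ℕ → ℝ := fun j => |t (j * N)| + B * a (j * N) with hV
    have hVdef : ∀ j, V j = |t (j * N)| + B * a (j * N) := fun j => rfl
    have hV0 : ∀ j, 0 ≤ V j := fun j => add_nonneg (abs_nonneg _) (mul_pos hB0 (ha0 _)).le
    have hdec : ∀ j, V (j + 1) ≤ V j - a (j * N) ∨ V (j + 1) ≤ (R + B) * a (j * N) := by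
      intro j
      have hle : a ((j + 1) * N) ≤ a (j * N) := ha (Nat.mul_le_mul_right _ j.le_succ)
      have hBle := mul_le_mul_of_nonneg_left hle hB0.le
      rw [hVdef, hVdef]
      by_cases hhalf : a (j * N) ≤ 2 * a ((j + 1) * N)
      · rcases hblock j hhalf with h1 | h1
        · left; linarith
        · right; linarith
      · left
        have h1 := hstepN j
        have h2 := abs_sub_abs_le_abs_sub (t ((j + 1) * N)) (t (j * N))
        have h3 : B * a ((j + 1) * N) ≤ B * (a (j * N) / 2) :=
          mul_le_mul_of_nonneg_left (by linarith) hB0.le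
        have h4 : B * (a (j * N) / 2) = C * N * a (j * N) + a (j * N) := by rw [hB]; ring
        linarith
    have hVlim : ∀ ε > 0, ∀ᶠ j in atTop, V j ≤ ε := by
      intro ε hε
      have h1 : Tendsto (fun j => (R + B) * a (j * N)) atTop (𝓝 0) := by
        simpa using hb.const_mul (R + B)
      obtain ⟨J, hJ⟩ := eventually_atTop.1 (h1.eventually_le_const hε)
      obtain ⟨j₀, hj₀, hj₁⟩ : ∃ j ≥ J, V (j + 1) ≤ (R + B) * a (j * N) := by
        by_contra! hcon
        refine hsum ((summable_nat_add_iff J).1 (summable_of_sum_range_le (c := V J)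
          (fun j => (ha0 _).le) fun n => ?_))
        have : ∀ n, ∑ i ∈ Finset.range n, a ((i + J) * N) ≤ V J - V (n + J) := by
          intro n
          induction n with
          | zero => simp
          | succ n ih =>
            rw [Finset.sum_range_succ]
            have h2 := (hdec (n + J)).resolve_right (not_le.2 (hcon _ (Nat.le_add_left _ _)))
            rw [show n + 1 + J = n + J + 1 by ring]
            linarith
        linarith [this n, hV0 (n + J)]
      refine eventually_atTop.2 ⟨j₀ + 1, fun j hj => ?_⟩
      induction j, hj using Nat.le_induction with
      | base => exact hj₁.trans (hJ j₀ hj₀)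
      | succ j hj ih =>
        rcases hdec j with h2 | h2
        · linarith [ha0 (j * N)]
        · exact h2.trans (hJ j (by omega))
    rw [Metric.tendsto_nhds]
    intro ε hε
    filter_upwards [hVlim (ε / 2) (by linarith)] with j hj
    rw [hVdef] at hj
    rw [Real.dist_0_eq_abs]
    linarith [mul_pos hB0 (ha0 (j * N))]

/-- The address `w` with all letters from position `n` on replaced by the lower left corner. -/
def trunc (n : ℕ) (w : Address) : Address := fun i => if i < n then w i else (false, false)

theorem trunc_mem_cyl (n : ℕ) (w : Address) : trunc n w ∈ cyl w n := fun i hi => by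
  simp [trunc, hi]

theorem trunc_eq_of_mem_cyl {n : ℕ} {w w' : Address} (hw : w' ∈ cyl w n) :
    trunc n w' = trunc n w := by
  ext1 i
  by_cases hi : i < n
  · simp [trunc, hi, hw i hi]
  · simp [trunc, hi]

/-- The coordinates in which the partial sum after `n` letters of `w` and its change over the next
`M` letters have the same sign. Reflecting those coordinates makes the change oppose the sum. -/
noncomputable def opposingFlip (lam : ℕ → ℝ) (n M : ℕ) (w : Address) : Bool × Bool :=
  let f := fun c => decide (0 < partialSum lam c n (trunc n w) *
    (partialSum lam c (n + M) (trunc (n + M) w) - partialSum lam c n (trunc (n + M) w)))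
  (f true, f false)

/-- The letter whose repetition drives the partial sum after `n` letters of `w` towards zero. -/
noncomputable def opposingLetter (lam : ℕ → ℝ) (n : ℕ) (w : Address) : Bool × Bool :=
  let f := fun c => decide (0 < partialSum lam c n (trunc n w))
  (f true, f false)

theorem axis_opposingFlip (lam : ℕ → ℝ) (c : Bool) (n M : ℕ) (w : Address) :
    axis c (opposingFlip lam n M w) = decide (0 < partialSum lam c n (trunc n w) *
      (partialSum lam c (n + M) (trunc (n + M) w) - partialSum lam c n (trunc (n + M) w))) := by
  cases c <;> simp [axis, opposingFlip]

theorem axis_opposingLetter (lam : ℕ → ℝ) (c : Bool) (n : ℕ) (w : Address) :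
    axis c (opposingLetter lam n w) = decide (0 < partialSum lam c n (trunc n w)) := by
  cases c <;> simp [axis, opposingLetter]

theorem abs_add_le_max_of_mul_nonpos {x y : ℝ} (hxy : x * y ≤ 0) : |x + y| ≤ max |x| |y| := by
  rcases le_total 0 x with hx | hx <;> rcases le_total 0 y with hy | hy
  · rcases mul_eq_zero.1 (le_antisymm hxy (mul_nonneg hx hy)) with e | e <;> simp [e]
  · refine abs_le.2 ⟨?_, ?_⟩
    · linarith [le_max_right |x| |y|, neg_abs_le y]
    · linarith [le_max_left |x| |y|, le_abs_self x]
  · refine abs_le.2 ⟨?_, ?_⟩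
    · linarith [le_max_left |x| |y|, neg_abs_le x]
    · linarith [le_max_right |x| |y|, le_abs_self y]
  · rcases mul_eq_zero.1 (le_antisymm hxy (mul_nonneg_of_nonpos_of_nonpos hx hy)) with e | e <;>
      simp [e]

theorem sgn_decide_mul_nonpos (x : ℝ) : sgn (decide (0 < x)) * x ≤ 0 := by
  by_cases hx : 0 < x
  · simp [sgn, hx, hx.le]
  · simp [sgn, hx, not_lt.1 hx]

section
variable {lam : ℕ → ℝ} {l : ℝ}

theorem abs_sgn (b : Bool) : |sgn b| = 1 := by cases b <;> simp [sgn]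

theorem partialSum_add_sub (lam : ℕ → ℝ) (c : Bool) (n i : ℕ) (w : Address) :
    partialSum lam c (n + i) w - partialSum lam c n w =
      ∑ j ∈ Finset.range i, increment lam c (n + j) w := by
  simp [partialSum, Finset.sum_range_add]

theorem abs_partialSum_add_sub_le (hl : l < 1 / 2) (h : ∀ n ≥ 1, 1 / 4 ≤ lam n ∧ lam n ≤ l)
    (c : Bool) (n i : ℕ) (w : Address) :
    |partialSum lam c (n + i) w - partialSum lam c n w| ≤ 1 / (1 - 2 * l) * i * density lam n := by
  have hd : 0 < 1 - 2 * l := by linarith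
  rw [partialSum_add_sub]
  refine (Finset.abs_sum_le_sum_abs _ _).trans ((Finset.sum_le_card_nsmul _ _
    (density lam n / (1 - 2 * l)) fun j _ => (abs_increment_le hl h c w _).trans ?_).trans_eq ?_)
  · exact div_le_div_of_nonneg_right (density_antitone h (n.le_add_right j)) hd.le
  · simp; ring

theorem partialSum_flipFrom_add_sub (hl : l < 1 / 2) (h : ∀ n ≥ 1, 1 / 4 ≤ lam n ∧ lam n ≤ l)
    (c : Bool) (n i : ℕ) (g : Bool × Bool) (w : Address) :
    partialSum lam c (n + i) (flipFrom n g w) - partialSum lam c n (flipFrom n g w) =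
      sgn (axis c g) * (partialSum lam c (n + i) w - partialSum lam c n w) := by
  rw [partialSum_add_sub, partialSum_add_sub, Finset.mul_sum]
  exact Finset.sum_congr rfl fun j _ => increment_flipFrom hl h c (n.le_add_right j) g w

theorem oscConst_pos (hl : l < 1 / 2) (hl0 : 0 < l) : 0 < oscConst l := by
  have hd : 0 < 1 - 2 * l := by linarith
  have hq : 0 < 1 - 4 * l ^ 2 := by nlinarith
  unfold oscConst; positivity

/-- The effect of a stretch of `M` letters that has been reflected by `opposingFlip`. -/
theorem abs_partialSum_le_of_flip (hl : l < 1 / 2) (h : ∀ n ≥ 1, 1 / 4 ≤ lam n ∧ lam n ≤ l)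
    (c : Bool) {n M : ℕ} {u w : Address}
    (hw : w ∈ cyl (flipFrom n (opposingFlip lam n M u) u) (n + M)) :
    |partialSum lam c (n + M) w| ≤
      max |partialSum lam c n w| (1 / (1 - 2 * l) * M * density lam n) +
        4 * oscConst l * density lam n := by
  -- `s` and `X` are what is known of the sum and of its change before the later letters are chosen
  set g := opposingFlip lam n M u with hg
  set x := trunc (n + M) u with hx
  set s := partialSum lam c n (trunc n u) with hs
  set X := partialSum lam c (n + M) x - partialSum lam c n x with hX
  have hK := oscConst_pos hl (by linarith [quarter_le h])
  have ha := density_pos h n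
  have ha' := mul_le_mul_of_nonneg_left (density_antitone h (n.le_add_right M)) hK.le
  have hwx : w ∈ cyl (flipFrom n g x) (n + M) := fun i hi => by
    rw [hw i hi, flipFrom_eq_iff]
    exact (trunc_mem_cyl (n + M) u i hi).symm
  have hwn : w ∈ cyl (trunc n u) n := fun i hi => by
    rw [hw i (by omega), flipFrom_of_lt _ _ hi]
    exact (trunc_mem_cyl n u i hi).symm
  have e1 := abs_le.1 (abs_partialSum_sub_le hl h c hwx)
  have e2 := abs_le.1 (abs_partialSum_sub_le hl h c (cyl_antitone _ (n.le_add_right M) hwx))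
  have e3 := abs_le.1 (abs_partialSum_sub_le hl h c hwn)
  have e4 := partialSum_flipFrom_add_sub hl h c n M g x
  have e5 : |s + sgn (axis c g) * X| ≤ max |s| |X| := by
    have h1 := abs_add_le_max_of_mul_nonpos (x := s) (y := sgn (axis c g) * X) (by
      have := sgn_decide_mul_nonpos (s * X)
      rw [hg, axis_opposingFlip]
      linarith)
    rwa [abs_mul, abs_sgn, one_mul] at h1
  have e6 := abs_partialSum_add_sub_le hl h c n M x
  have e7 : max |s| |X| ≤ max |partialSum lam c n w| (1 / (1 - 2 * l) * M * density lam n) +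
      oscConst l * density lam n := by
    refine max_le ?_ ?_
    · have h1 := abs_sub_abs_le_abs_sub s (partialSum lam c n w)
      have h2 : |s - partialSum lam c n w| ≤ oscConst l * density lam n :=
        abs_le.2 ⟨by linarith, by linarith⟩
      linarith [le_max_left |partialSum lam c n w| (1 / (1 - 2 * l) * M * density lam n)]
    · have := mul_pos hK ha
      linarith [le_max_right |partialSum lam c n w| (1 / (1 - 2 * l) * M * density lam n)]
  have e8 := abs_le.1 (e5.trans e7)
  rw [abs_le]
  constructor <;> linarith

/-- The effect of a stretch of `q + r` equal letters chosen by `opposingLetter`. -/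
theorem abs_partialSum_le_of_letter (hl : l < 1 / 2) (h : ∀ n ≥ 1, 1 / 4 ≤ lam n ∧ lam n ≤ l)
    (c : Bool) {r q n : ℕ} {α : ℝ} (hr : l ^ r ≤ (1 - 2 * l) ^ 3 / 16)
    (hα : ∀ k < n + (q + r), α ≤ density lam k)
    (hgain : r / (1 - 2 * l) * density lam n ≤ (1 - 2 * l) / 16 * q * α)
    {u w : Address} (hu : w ∈ cyl u n)
    (hw : ∀ i, n ≤ i → i < n + (q + r) → w i = opposingLetter lam n u) :
    |partialSum lam c (n + (q + r)) w| ≤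
      max (|partialSum lam c n w| -
          ((1 - 2 * l) / 16 * q * α - r / (1 - 2 * l) * density lam n))
        (1 / (1 - 2 * l) * (q + r : ℕ) * density lam n) + 2 * oscConst l * density lam n := by
  have hd : 0 < 1 - 2 * l := by linarith
  have hK := oscConst_pos hl (by linarith [quarter_le h])
  have ha := density_pos h n
  set v := opposingLetter lam n u with hv
  set s := partialSum lam c n (trunc n u) with hs
  set Z := partialSum lam c (n + (q + r)) w - partialSum lam c n w with hZ
  have hwn : w ∈ cyl (trunc n u) n := fun i hi => by
    rw [hu i hi]; exact (trunc_mem_cyl n u i hi).symm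
  have e3 := abs_le.1 (abs_partialSum_sub_le hl h c hwn)
  have e6 : |Z| ≤ _ := abs_partialSum_add_sub_le hl h c n (q + r) w
  have e6' := abs_le.1 e6
  -- all but the last `r` increments of the stretch have the sign prescribed by the letter
  have hG : (1 - 2 * l) / 16 * q * α - r / (1 - 2 * l) * density lam n ≤ sgn (axis c v) * Z := by
    rw [hZ, partialSum_add_sub, Finset.sum_range_add, mul_add, Finset.mul_sum]
    have h1 : (1 - 2 * l) / 16 * q * α ≤
        ∑ j ∈ Finset.range q, sgn (axis c v) * increment lam c (n + j) w := by
      refine le_of_eq_of_le ?_ (Finset.card_nsmul_le_sum _ _ ((1 - 2 * l) / 16 * α) fun j hj => ?_)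
      · simp; ring
      · have hj := Finset.mem_range.1 hj
        refine le_trans (mul_le_mul_of_nonneg_left (hα (n + j) (by omega)) (by positivity))
          (le_sgn_mul_increment hl h c hr (n := n + (q + r)) (by omega)
            (fun i h1 h2 => hw i (by omega) h2) (by omega))
    have h2 := abs_partialSum_add_sub_le hl h c (n + q) r w
    rw [partialSum_add_sub] at h2
    have h3 : 1 / (1 - 2 * l) * r * density lam (n + q) ≤ r / (1 - 2 * l) * density lam n := by
      rw [one_div_mul_eq_div]
      exact mul_le_mul_of_nonneg_left (density_antitone h (n.le_add_right q)) (by positivity)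
    simp only [add_assoc] at h2
    have h4 := neg_abs_le (sgn (axis c v) * ∑ j ∈ Finset.range r, increment lam c (n + (q + j)) w)
    rw [abs_mul, abs_sgn, one_mul] at h4
    linarith
  set G := (1 - 2 * l) / 16 * q * α - r / (1 - 2 * l) * density lam n with hGdef
  have hG0 : 0 ≤ G := by linarith
  set T := 1 / (1 - 2 * l) * (q + r : ℕ) * density lam n with hT
  have e8 : |s + Z| ≤ max (|s| - G) T := by
    rw [hv, axis_opposingLetter, ← hs] at hG
    by_cases hs0 : 0 < s
    · simp only [sgn, hs0, decide_true, if_true] at hG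
      rw [abs_of_pos hs0, abs_le]
      constructor <;> linarith [le_max_left (s - G) T, le_max_right (s - G) T]
    · simp only [sgn, hs0, decide_false, Bool.false_eq_true, if_false] at hG
      rw [abs_of_nonpos (not_lt.1 hs0), abs_le]
      constructor <;> linarith [le_max_left (-s - G) T, le_max_right (-s - G) T]
  have e9 : max (|s| - G) T ≤ max (|partialSum lam c n w| - G) T + oscConst l * density lam n := by
    have := mul_pos hK ha
    refine max_le ?_ ?_
    · have h1 := abs_sub_abs_le_abs_sub s (partialSum lam c n w)
      have h2 : |s - partialSum lam c n w| ≤ oscConst l * density lam n :=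
        abs_le.2 ⟨by linarith, by linarith⟩
      linarith [le_max_left (|partialSum lam c n w| - G) T]
    · linarith [le_max_right (|partialSum lam c n w| - G) T]
  have e10 := abs_le.1 (e8.trans e9)
  rw [abs_le]
  constructor <;> linarith

/-- The effect of a block of `M` reflected letters followed by `m` equal letters. The
length `m` is chosen before `M`. -/
theorem exists_block_decrease (hl : l < 1 / 2) (h : ∀ n ≥ 1, 1 / 4 ≤ lam n ∧ lam n ≤ l) :
    ∃ m : ℕ, ∀ M : ℕ, ∃ R : ℝ, ∀ (c : Bool) (n : ℕ) (u w : Address),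
      w ∈ cyl (flipFrom n (opposingFlip lam n M u) u) (n + M) →
      (∀ i, n + M ≤ i → i < n + M + m →
        w i = opposingLetter lam (n + M) (flipFrom n (opposingFlip lam n M u) u)) →
      density lam n ≤ 2 * density lam (n + (M + m)) →
      |partialSum lam c (n + (M + m)) w| ≤ |partialSum lam c n w| - density lam n ∨
        |partialSum lam c (n + (M + m)) w| ≤ R * density lam n := by
  have hl0 : 0 < l := by linarith [quarter_le h]
  have hd : 0 < 1 - 2 * l := by linarith
  have hK := oscConst_pos hl hl0
  obtain ⟨r, hr⟩ := exists_pow_lt_of_lt_one (show 0 < (1 - 2 * l) ^ 3 / 16 by positivity)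
    (show l < 1 by linarith)
  -- the gain over `q` letters has to exceed the loss over the last `r` forced letters and the
  -- errors of both stretches by at least `density lam n`
  obtain ⟨q, hq⟩ := exists_nat_ge ((r / (1 - 2 * l) + 6 * oscConst l + 1) / ((1 - 2 * l) / 32))
  rw [div_le_iff₀ (by positivity)] at hq
  refine ⟨q + r, fun M =>
    ⟨1 / (1 - 2 * l) * M + 1 / (1 - 2 * l) * (q + r : ℕ) + 6 * oscConst l, ?_⟩⟩
  intro c n u w hw hw' hhalf
  have ha := density_pos h n
  have ha' := density_antitone h (n.le_add_right M)
  have hqa := mul_le_mul_of_nonneg_right hq ha.le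
  have hra : r / (1 - 2 * l) * density lam (n + M) ≤ r / (1 - 2 * l) * density lam n :=
    mul_le_mul_of_nonneg_left ha' (by positivity)
  have hKa := mul_pos hK ha
  have s1 := abs_partialSum_le_of_flip hl h c hw
  have s2 := abs_partialSum_le_of_letter hl h c hr.le (α := density lam n / 2) (q := q)
    (fun k hk => by
      have := density_antitone h (show k ≤ n + (M + (q + r)) by omega)
      linarith) (by linarith) hw hw'
  rw [show n + (M + (q + r)) = n + M + (q + r) by ring]
  have hKa' := mul_le_mul_of_nonneg_left ha' hK.le
  have hTa : 1 / (1 - 2 * l) * (q + r : ℕ) * density lam (n + M) ≤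
      1 / (1 - 2 * l) * (q + r : ℕ) * density lam n :=
    mul_le_mul_of_nonneg_left ha' (by positivity)
  have hP : 0 ≤ 1 / (1 - 2 * l) * (q + r : ℕ) * density lam n := by positivity
  have hP' : 0 ≤ 1 / (1 - 2 * l) * M * density lam n := by positivity
  rcases max_choice (|partialSum lam c (n + M) w| - ((1 - 2 * l) / 16 * q * (density lam n / 2) -
    r / (1 - 2 * l) * density lam (n + M))) (1 / (1 - 2 * l) * (q + r : ℕ) * density lam (n + M))
    with e | e <;> rw [e] at s2
  · rcases max_choice |partialSum lam c n w| (1 / (1 - 2 * l) * M * density lam n) with e' | e' <;>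
      rw [e'] at s1
    · left; linarith
    · right; linarith
  · right; linarith

end


/-! ### Steered addresses -/

/-- The first `j` blocks of the steered address: in each block the first `M` letters are those of
`ω`, reflected so as to oppose the current partial sums, and the following `m` letters are equal
and drive these sums towards zero. Only the letters up to position `j * (M + m)` matter. -/
noncomputable def steeredBlocks (lam : ℕ → ℝ) (M m : ℕ) (ω : Address) : ℕ → Address
  | 0 => fun _ => (false, false)
  | j + 1 =>
    let n := j * (M + m)
    let u : Address := fun i => if i < n then steeredBlocks lam M m ω j i else ω i
    let u' := flipFrom n (opposingFlip lam n M u) u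
    fun i => if i < n + M then u' i else opposingLetter lam (n + M) u'

/-- The address obtained from `ω` by steering all blocks. -/
noncomputable def steered (lam : ℕ → ℝ) (M m : ℕ) (ω : Address) : Address :=
  fun i => steeredBlocks lam M m ω (i + 1) i

/-- The address whose block `j` is to be reflected: the first `j` steered blocks followed by the
free letters of `ω`. -/
noncomputable def unsteered (lam : ℕ → ℝ) (M m : ℕ) (ω : Address) (j : ℕ) : Address :=
  fun i => if i < j * (M + m) then steeredBlocks lam M m ω j i else ω i

theorem steeredBlocks_succ (lam : ℕ → ℝ) (M m : ℕ) (ω : Address) (j : ℕ) :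
    steeredBlocks lam M m ω (j + 1) = fun i =>
      if i < j * (M + m) + M then
        flipFrom (j * (M + m)) (opposingFlip lam (j * (M + m)) M (unsteered lam M m ω j))
          (unsteered lam M m ω j) i
      else opposingLetter lam (j * (M + m) + M)
        (flipFrom (j * (M + m)) (opposingFlip lam (j * (M + m)) M (unsteered lam M m ω j))
          (unsteered lam M m ω j)) := rfl

theorem steeredBlocks_mem_cyl (lam : ℕ → ℝ) (M m : ℕ) (ω : Address) {j j' : ℕ} (hj : j ≤ j') :
    steeredBlocks lam M m ω j' ∈ cyl (steeredBlocks lam M m ω j) (j * (M + m)) := by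
  induction j', hj using Nat.le_induction with
  | base => exact self_mem_cyl _ _
  | succ j' hj ih =>
    intro i hi
    have hi' : i < j' * (M + m) := hi.trans_le (Nat.mul_le_mul_right _ hj)
    rw [← ih i hi, steeredBlocks_succ]
    simp only [show i < j' * (M + m) + M by omega, if_true, flipFrom_of_lt _ _ hi', unsteered, hi']

theorem steered_mem_cyl (lam : ℕ → ℝ) {M m : ℕ} (hN : 0 < M + m) (ω : Address) (j : ℕ) :
    steered lam M m ω ∈ cyl (steeredBlocks lam M m ω j) (j * (M + m)) := by
  intro i hi
  have hi' : i < (i + 1) * (M + m) := by nlinarith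
  rcases le_total j (i + 1) with hj | hj
  · exact steeredBlocks_mem_cyl lam M m ω hj i hi
  · exact (steeredBlocks_mem_cyl lam M m ω hj i hi').symm

theorem steeredBlocks_eq_of_mem_cyl (lam : ℕ → ℝ) (M m : ℕ) {ω ω' : Address} {j : ℕ}
    (hω : ω' ∈ cyl ω (j * (M + m))) :
    steeredBlocks lam M m ω' j = steeredBlocks lam M m ω j := by
  induction j with
  | zero => rfl
  | succ j ih =>
    rw [Nat.succ_mul] at hω
    have hu : unsteered lam M m ω' j ∈ cyl (unsteered lam M m ω j) (j * (M + m) + M) := by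
      intro i hi
      simp only [unsteered, ih (cyl_antitone _ (Nat.le_add_right _ _) hω)]
      split_ifs
      · rfl
      · exact hω i (by omega)
    have hg : opposingFlip lam (j * (M + m)) M (unsteered lam M m ω' j) =
        opposingFlip lam (j * (M + m)) M (unsteered lam M m ω j) := by
      simp only [opposingFlip, trunc_eq_of_mem_cyl hu,
        trunc_eq_of_mem_cyl (cyl_antitone _ (Nat.le_add_right _ _) hu)]
    rw [steeredBlocks_succ, steeredBlocks_succ, hg]
    have hu' := (flipFrom_mem_cyl_iff (n := j * (M + m))
      (opposingFlip lam (j * (M + m)) M (unsteered lam M m ω j)) _ _ _).2 hu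
    ext1 i
    simp only [opposingLetter, trunc_eq_of_mem_cyl hu']
    split_ifs with hi
    · exact hu' i hi
    · rfl

theorem isOpen_cyl (w : Address) (n : ℕ) : IsOpen (cyl w n) := by
  rw [cyl_eq, setOf_fixed_eq]
  exact isOpen_set_pi (Finset.finite_toSet _) fun _ _ => isOpen_discrete _

theorem measurable_steered (lam : ℕ → ℝ) (M m : ℕ) :
    Measurable (steered lam M m) := by
  refine measurable_pi_lambda _ fun i => ?_
  have hloc : IsLocallyConstant fun ω => steered lam M m ω i := by
    refine (IsLocallyConstant.iff_exists_open _).2 fun ω =>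
      ⟨cyl ω ((i + 1) * (M + m)), isOpen_cyl _ _, self_mem_cyl _ _, fun ω' hω' => ?_⟩
    simp only [steered, steeredBlocks_eq_of_mem_cyl lam M m hω']
  intro s _
  exact (hloc s).measurableSet

/-- In the free part of block `j`, the steered address is a reflection of the original one. -/
theorem exists_steered_eq_xor (lam : ℕ → ℝ) {M m : ℕ} (hN : 0 < M + m) (ω : Address) (j : ℕ) :
    ∃ g : Bool × Bool, ∀ i < M, ω (j * (M + m) + i) =
      (xor (steered lam M m ω (j * (M + m) + i)).1 g.1,
        xor (steered lam M m ω (j * (M + m) + i)).2 g.2) := by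
  refine ⟨opposingFlip lam (j * (M + m)) M (unsteered lam M m ω j), fun i hi => ?_⟩
  rw [steered_mem_cyl lam hN ω (j + 1) (j * (M + m) + i) (by rw [Nat.succ_mul]; omega),
    steeredBlocks_succ]
  simp [hi, flipFrom, unsteered]

/-- Steering concentrates the measure only slightly: a steered prefix of `J` blocks leaves `4`
possible reflections for each block, and determines the free letters once these are known. -/
theorem addressMeasure_steered_preimage_cyl_le (lam : ℕ → ℝ) {M m : ℕ} (hN : 0 < M + m)
    (w : Address) (J : ℕ) :
    addressMeasure (steered lam M m ⁻¹' cyl w (J * (M + m))) ≤ 4 ^ J * (4 ^ (J * M))⁻¹ := by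
  set N := M + m with hNdef
  -- the positions of the free letters in the first `J` blocks
  let S : Finset ℕ := (Finset.range J ×ˢ Finset.range M).image fun p => p.1 * N + p.2
  have hdiv : ∀ j i, i < M → (j * N + i) / N = j ∧ (j * N + i) % N = i := fun j i hi => by
    have hi' : i < N := by omega
    refine ⟨?_, ?_⟩
    · rw [mul_comm, Nat.mul_add_div hN, Nat.div_eq_of_lt hi', add_zero]
    · rw [mul_comm, Nat.mul_add_mod, Nat.mod_eq_of_lt hi']
  have hS : S.card = J * M := by
    rw [Finset.card_image_of_injOn, Finset.card_product, Finset.card_range, Finset.card_range]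
    rintro ⟨j, i⟩ hp ⟨j', i'⟩ hp' e
    simp only [Finset.coe_product, Set.mem_prod, Finset.mem_coe, Finset.mem_range] at hp hp' e
    obtain ⟨h1, h2⟩ := hdiv j i hp.2
    obtain ⟨h3, h4⟩ := hdiv j' i' hp'.2
    rw [Prod.mk.injEq]
    exact ⟨by rw [← h1, e, h3], by rw [← h2, e, h4]⟩
  let z : (Fin J → Bool × Bool) → Address := fun G i =>
    if hi : i / N < J then (xor (w i).1 (G ⟨i / N, hi⟩).1, xor (w i).2 (G ⟨i / N, hi⟩).2)
    else w i
  have hsub : steered lam M m ⁻¹' cyl w (J * N) ⊆ ⋃ G, {ω | ∀ i ∈ S, ω i = z G i} := by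
    intro ω hω
    choose g hg using exists_steered_eq_xor lam hN ω
    refine Set.mem_iUnion.2 ⟨fun j => g j, fun i hi => ?_⟩
    obtain ⟨⟨j, i⟩, hp, rfl⟩ := Finset.mem_image.1 hi
    simp only [Finset.mem_product, Finset.mem_range] at hp
    have hlt : j * N + i < J * N := by nlinarith [hp.1, hp.2]
    simp only [z, (hdiv j i hp.2).1, hp.1, dite_true]
    rw [hg j i hp.2, hω _ hlt]
  refine (measure_mono hsub).trans ((measure_iUnion_fintype_le _ _).trans_eq ?_)
  simp [addressMeasure_fixed, hS]

section
variable {lam : ℕ → ℝ} {l : ℝ}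

/-- For a suitable length `m` of the forced stretches, steering makes the partial sums converge,
however long the free stretches are. -/
theorem exists_tendsto_partialSum_steered (hl : l < 1 / 2)
    (h : ∀ n ≥ 1, 1 / 4 ≤ lam n ∧ lam n ≤ l) (ha : Tendsto (density lam) atTop (𝓝 0)) :
    ∃ m : ℕ, ∀ M : ℕ, 0 < M + m → ∀ (ω : Address) (c : Bool),
      ∃ L, Tendsto (fun n => partialSum lam c n (steered lam M m ω)) atTop (𝓝 L) := by
  have hd : 0 < 1 - 2 * l := by linarith
  obtain ⟨m, hm⟩ := exists_block_decrease hl h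
  refine ⟨m, fun M hN ω c => ?_⟩
  obtain ⟨R, hR⟩ := hm M
  refine exists_tendsto_of_block_decrease (C := 1 / (1 - 2 * l)) (R := R) hN (density_antitone h)
    (density_pos h) ha (by positivity) (fun n => ?_) fun j hj => ?_
  · simpa using abs_partialSum_add_sub_le hl h c n 1 (steered lam M m ω)
  · rw [Nat.succ_mul] at hj ⊢
    have hw := steered_mem_cyl lam hN ω (j + 1)
    rw [Nat.succ_mul] at hw
    refine hR c (j * (M + m)) (unsteered lam M m ω j) _ (fun i hi => ?_) (fun i h1 h2 => ?_) hj
    · rw [hw i (by omega), steeredBlocks_succ]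
      simp [hi]
    · rw [hw i (by omega), steeredBlocks_succ]
      simp [h1.not_gt]

/-! ### Dimension of the set of principal values -/

/-- The mass distribution principle for the law of a random address. -/
theorem le_dimH_of_preimage_cyl_le (hl : l < 1 / 2) (h : ∀ n ≥ 1, 1 / 4 ≤ lam n ∧ lam n ≤ l)
    {W : Address → Address} (hW : Measurable W) {C : ℝ} {d : NNReal} (hd : 0 < d)
    (hb : ∀ w n, addressMeasure.real (W ⁻¹' cyl w n) ≤ C * side lam n ^ (d : ℝ))
    {E : Set ℂ} (hE : ∀ ω, point lam (W ω) ∈ E) : (d : ENNReal) ≤ dimH E := by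
  have hg : 0 < 1 - 2 * l := by linarith
  have hd' : (0 : ℝ) < d := hd
  have hside0 : side lam 0 = 1 := by simp [side]
  have hC : 0 < C := by
    have := hb (fun _ => (false, false)) 0
    have e : W ⁻¹' cyl (fun _ => (false, false)) 0 = Set.univ := by ext; simp [cyl]
    rw [e, probReal_univ, hside0, Real.one_rpow] at this
    linarith
  have hf : Measurable fun ω => point lam (W ω) := (continuous_point hl h).measurable.comp hW
  set ν : Measure ℂ := addressMeasure.map fun ω => point lam (W ω) with hν
  set K : ℝ := C * (1 - 2 * l)⁻¹ ^ (d : ℝ) with hK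
  have hK0 : 0 < K := by positivity
  -- the closure is taken because the measure of `A` is only computed for measurable `A`
  have key : ∀ A : Set ℂ, Metric.ediam A ≤ ENNReal.ofReal ((1 - 2 * l) / 2) →
      ν A ≤ ENNReal.ofReal K * Metric.ediam A ^ (d : ℝ) := by
    intro A hA
    have hfin : Metric.ediam A ≠ ⊤ := ne_top_of_le_ne_top ENNReal.ofReal_ne_top hA
    set ρ : ℝ := (Metric.ediam A).toReal with hρ
    have hρe : Metric.ediam A = ENNReal.ofReal ρ := (ENNReal.ofReal_toReal hfin).symm
    have hρ0 : 0 ≤ ρ := ENNReal.toReal_nonneg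
    have hρ1 : ρ < 1 - 2 * l := by
      have := ENNReal.toReal_le_of_le_ofReal (by linarith) hA
      linarith
    have hF : addressMeasure.real ((fun ω => point lam (W ω)) ⁻¹' closure A) ≤ K * ρ ^ (d : ℝ) := by
      rcases Set.eq_empty_or_nonempty ((fun ω => point lam (W ω)) ⁻¹' closure A) with he | ⟨ω₀, h0⟩
      · rw [he, measureReal_empty]; positivity
      have hdist : ∀ ω ∈ (fun ω => point lam (W ω)) ⁻¹' closure A,
          ‖point lam (W ω) - point lam (W ω₀)‖ ≤ ρ := fun ω hω => by
        rw [← dist_eq_norm, ← ENNReal.ofReal_le_ofReal_iff hρ0, ← edist_dist, ← hρe,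
          ← Metric.ediam_closure]
        exact Metric.edist_le_ediam_of_mem hω h0
      have hn : ∀ n, ρ < (1 - 2 * l) * side lam n →
          addressMeasure.real ((fun ω => point lam (W ω)) ⁻¹' closure A) ≤
            C * side lam (n + 1) ^ (d : ℝ) := fun n hn => by
        refine (measureReal_mono fun ω hω => ?_).trans (hb (W ω₀) (n + 1))
        by_contra hc
        exact absurd (hdist ω hω) (not_le.2 (hn.trans_le (le_norm_point_sub_of_notMem_cyl hl h hc)))
      rcases hρ0.eq_or_lt with e | hpos
      · rw [← e, Real.zero_rpow hd'.ne', mul_zero]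
        have h1 : Tendsto (fun n => C * side lam (n + 1) ^ (d : ℝ)) atTop (𝓝 0) := by
          have := (((tendsto_side hl h).comp (tendsto_add_atTop_nat 1)).rpow_const
            (p := (d : ℝ)) (Or.inr hd'.le)).const_mul C
          simpa [Real.zero_rpow hd'.ne'] using this
        exact ge_of_tendsto' h1 fun n => hn n (e ▸ gap_pos hl h n)
      · have hex : ∃ m, (1 - 2 * l) * side lam m ≤ ρ := by
          have := (tendsto_side hl h).const_mul (1 - 2 * l)
          rw [mul_zero] at this
          obtain ⟨m, hm⟩ := (this.eventually_le_const hpos).exists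
          exact ⟨m, hm⟩
        classical
        obtain ⟨n, hnf⟩ : ∃ n, Nat.find hex = n + 1 := by
          refine Nat.exists_eq_succ_of_ne_zero fun e => ?_
          have h0 := Nat.find_spec hex
          rw [e, hside0] at h0
          linarith
        have e1 : (1 - 2 * l) * side lam (n + 1) ≤ ρ := hnf ▸ Nat.find_spec hex
        have e2 : ρ < (1 - 2 * l) * side lam n := not_le.1 (Nat.find_min hex (by omega))
        refine (hn n e2).trans ?_
        rw [hK, mul_assoc, ← Real.mul_rpow (by positivity) hρ0]
        refine mul_le_mul_of_nonneg_left (Real.rpow_le_rpow (side_pos h _).le ?_ hd'.le) hC.le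
        rw [inv_mul_eq_div, le_div_iff₀ hg]
        linarith
    calc ν A ≤ ν (closure A) := measure_mono subset_closure
      _ = ENNReal.ofReal (addressMeasure.real ((fun ω => point lam (W ω)) ⁻¹' closure A)) := by
        rw [hν, Measure.map_apply hf isClosed_closure.measurableSet, ofReal_measureReal]
      _ ≤ ENNReal.ofReal (K * ρ ^ (d : ℝ)) := ENNReal.ofReal_le_ofReal hF
      _ = _ := by
        rw [ENNReal.ofReal_mul hK0.le, hρe, ENNReal.ofReal_rpow_of_nonneg hρ0 hd'.le]
  have hKe : ENNReal.ofReal K ≠ 0 := (ENNReal.ofReal_pos.2 hK0).ne'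
  have hle : (ENNReal.ofReal K)⁻¹ • ν ≤ Measure.hausdorffMeasure (d : ℝ) := by
    refine Measure.le_hausdorffMeasure _ _ (ENNReal.ofReal ((1 - 2 * l) / 2))
      (ENNReal.ofReal_pos.2 (by linarith)) fun A hA => ?_
    rw [Measure.smul_apply, smul_eq_mul, ENNReal.inv_mul_le_iff hKe ENNReal.ofReal_ne_top]
    exact key A hA
  have hνE : 1 ≤ ν E := by
    refine le_trans ?_ (Measure.le_map_apply hf.aemeasurable E)
    rw [Set.preimage_eq_univ_iff.2 (by rintro _ ⟨ω, rfl⟩; exact hE ω), measure_univ]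
  refine le_dimH_of_hausdorffMeasure_ne_zero fun h0 => ?_
  have := hle E
  rw [h0, Measure.smul_apply, smul_eq_mul, nonpos_iff_eq_zero, mul_eq_zero, ENNReal.inv_eq_zero]
    at this
  rcases this with h1 | h1
  · exact ENNReal.ofReal_ne_top h1
  · rw [h1] at hνE; exact absurd hνE (by simp)

/-- If only a small proportion of the letters is forced, the law of the steered point has nearly
the dimension one. -/
theorem steered_preimage_cyl_le_rpow (hl : l < 1 / 2) (h : ∀ n ≥ 1, 1 / 4 ≤ lam n ∧ lam n ≤ l)
    {M m L : ℕ} (hL : 0 < L) (hML : M + m = 2 * (m + 1) * L) (w : Address) (n : ℕ) :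
    addressMeasure.real (steered lam M m ⁻¹' cyl w n) ≤
      4 ^ (M + m) * side lam n ^ (1 - 1 / (L : ℝ)) := by
  have hN : 0 < M + m := by rw [hML]; positivity
  have hsn := side_pos h n
  set J := n / (M + m) with hJ
  have hJn : J * (M + m) ≤ n := Nat.div_mul_le_self _ _
  have hnJ : n ≤ M + m + J * (M + m) := by
    have := Nat.div_add_mod' n (M + m)
    have := Nat.mod_lt n hN
    rw [hJ]
    omega
  have h1 : addressMeasure.real (steered lam M m ⁻¹' cyl w n) ≤ 4 ^ J * (4 ^ (J * M))⁻¹ := by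
    refine (measureReal_mono (Set.preimage_mono (cyl_antitone w hJn))).trans ?_
    refine ENNReal.toReal_le_of_le_ofReal (by positivity)
      ((addressMeasure_steered_preimage_cyl_le lam hN w J).trans_eq ?_)
    rw [ENNReal.ofReal_mul (by positivity), ENNReal.ofReal_inv_of_pos (by positivity),
      ENNReal.ofReal_pow (by norm_num), ENNReal.ofReal_pow (by norm_num)]
    norm_num
  have h2 : (4 : ℝ) ^ J * (4 ^ (J * M))⁻¹ ≤ 4 ^ (M + m) * (4 ^ (J * (m + 1)) * (4 ^ n)⁻¹) := by
    have e : (4 : ℝ) ^ J * (4 ^ (J * M))⁻¹ = 4 ^ (J * (m + 1)) * (4 ^ (J * (M + m)))⁻¹ := by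
      rw [← div_eq_mul_inv, ← div_eq_mul_inv, div_eq_div_iff (by positivity) (by positivity),
        ← pow_add, ← pow_add]
      ring_nf
    rw [e, mul_left_comm]
    refine mul_le_mul_of_nonneg_left ?_ (by positivity)
    rw [← div_eq_mul_inv, le_div_iff₀ (by positivity), inv_mul_le_iff₀ (by positivity), ← pow_add]
    exact pow_le_pow_right₀ (by norm_num) (by omega)
  have h3 : ((4 : ℝ) ^ n)⁻¹ ≤ side lam n := by
    rw [inv_four_pow_eq h]
    have : density lam n ≤ 1 := (density_antitone h n.zero_le).trans_eq (by simp [density, side])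
    exact mul_le_of_le_one_left hsn.le this
  have h4 : (4 : ℝ) ^ (J * (m + 1)) ≤ side lam n ^ (-(1 / (L : ℝ))) := by
    have hs2 : side lam n ≤ (1 / 2) ^ n := by
      have := side_add_le h (by linarith [quarter_le h]) 0 n
      simp only [zero_add, side, Finset.Icc_eq_empty_of_lt zero_lt_one, Finset.prod_empty, mul_one]
        at this ⊢
      exact this.trans (pow_le_pow_left₀ (by linarith [quarter_le h]) hl.le n)
    have e : ((4 : ℝ) ^ (J * (m + 1))) ^ L ≤ (side lam n)⁻¹ := by
      rw [le_inv_comm₀ (by positivity) hsn, ← pow_mul]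
      refine hs2.trans ?_
      rw [one_div, inv_pow]
      refine inv_anti₀ (by positivity) ?_
      rw [show (4 : ℝ) = 2 ^ 2 by norm_num, ← pow_mul]
      refine pow_le_pow_right₀ (by norm_num) (le_of_eq_of_le ?_ hJn)
      rw [hML]; ring
    rw [Real.rpow_neg hsn.le, ← Real.inv_rpow hsn.le]
    calc (4 : ℝ) ^ (J * (m + 1)) = (((4 : ℝ) ^ (J * (m + 1))) ^ L) ^ (1 / (L : ℝ)) := by
          rw [one_div, Real.pow_rpow_inv_natCast (by positivity) hL.ne']
      _ ≤ _ := Real.rpow_le_rpow (by positivity) e (by positivity)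
  refine h1.trans (h2.trans (mul_le_mul_of_nonneg_left ?_ (by positivity)))
  rw [sub_eq_neg_add, Real.rpow_add hsn, Real.rpow_one]
  exact mul_le_mul h4 h3 (by positivity) (by positivity)

theorem one_le_dimH_principalValueSet (hl : l < 1 / 2) (h : ∀ n ≥ 1, 1 / 4 ≤ lam n ∧ lam n ≤ l)
    (ha : Tendsto (density lam) atTop (𝓝 0)) : 1 ≤ dimH (principalValueSet lam) := by
  obtain ⟨m, hm⟩ := exists_tendsto_partialSum_steered hl h ha
  have hbound : ∀ L : ℕ,
      ENNReal.ofReal (1 - 1 / ((L + 2 : ℕ) : ℝ)) ≤ dimH (principalValueSet lam) := by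
    intro L
    obtain ⟨M, hM⟩ : ∃ M, M + m = 2 * (m + 1) * (L + 2) :=
      ⟨2 * (m + 1) * (L + 2) - m, Nat.sub_add_cancel (by nlinarith)⟩
    have hN : 0 < M + m := by rw [hM]; positivity
    have hpos : 0 < 1 - 1 / ((L + 2 : ℕ) : ℝ) := by
      rw [sub_pos, div_lt_one (by positivity)]
      push_cast; linarith [(Nat.cast_nonneg L : (0 : ℝ) ≤ L)]
    refine le_dimH_of_preimage_cyl_le hl h (measurable_steered lam M m) (C := 4 ^ (M + m))
      (d := Real.toNNReal (1 - 1 / ((L + 2 : ℕ) : ℝ))) (Real.toNNReal_pos.2 hpos)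
      (fun w n => ?_) fun ω => ⟨point_mem_cantorSet hl h _, ?_⟩
    · rw [Real.coe_toNNReal _ hpos.le]
      exact steered_preimage_cyl_le_rpow hl h (by omega) hM w n
    · choose T hT using hm M hN ω
      exact ⟨_, hasPrincipalValue_of_tendsto hl h ha hT⟩
  have h1 : Tendsto (fun L : ℕ => 1 - 1 / ((L + 2 : ℕ) : ℝ)) atTop (𝓝 (1 - 0)) :=
    tendsto_const_nhds.sub
      ((tendsto_one_div_atTop_nhds_zero_nat (𝕜 := ℝ)).comp (tendsto_add_atTop_nat 2))
  have h2 := ENNReal.tendsto_ofReal h1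
  rw [sub_zero, ENNReal.ofReal_one] at h2
  exact le_of_tendsto' h2 hbound

end
end CornerCantor

theorem theorem1p1 (lam : ℕ → ℝ) (l : ℝ) (hl : l < 1 / 2)
    (hlam : ∀ n ≥ 1, 1 / 4 ≤ lam n ∧ lam n ≤ l)
    (ha : Tendsto (CornerCantor.density lam) atTop (𝓝 0)) :
    1 ≤ dimH (CornerCantor.principalValueSet lam) ∧
      (dimH (CornerCantor.cantorSet lam) = 1 →
        dimH (CornerCantor.principalValueSet lam) = 1) := by
  have h1 := CornerCantor.one_le_dimH_principalValueSet hl hlam ha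
  exact ⟨h1, fun hK => le_antisymm (hK ▸ dimH_mono fun _ hz => hz.1) h1⟩
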